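/- Let $(W,S)$ be an indecomposable Coxeter system with $S$ finite and non-empty, with entries $m_{s,t}$ of its Coxeter matrix ($s,t\in S$). Its Coxeter-Dynkin diagram $\Gamma$ has vertex set $S$; distinct $s,t$ are joined by an edge iff $m_{s,t}\neq 2$, and this edge carries the label $m_{s,t}\in\{3,4,\dots,\infty\}$. An edge is called labeled if its label is not $3$. Let $\mathbf H$ be the Hecke algebra of $(W,S)$ over $\mathbb Z[v,v^{-1}]$, with generators $H_s$ ($s\in S$) subject to $H_s^2=1+(v^{-1}-v)H_s$ and the braid relations, with standard basis $\{H_w\}_{w\in W}$. Its Kazhdan-Lusztig basis $\{\underline H_w\}_{w\in W}$ is characterized by: $\underline H_w$ is invariant under the ring involution $v\mapsto v^{-1}$, $H_s\mapsto H_s^{-1}$, and $\underline H_w\in H_w+\sum_{y\in W} v\mathbb Z[v]H_y$. Let $\le_J$ be the two-sided preorder on $W$, generated by the relations $x\le_J y$ whenever $\underline H_y$ appears with a non-zero coefficient in the expansion of $\underline H_a\underline H_x\underline H_b$ in the Kazhdan-Lusztig basis, for some $a,b\in W$. Its equivalence classes are the two-sided cells. Then all simple reflections $s\in S$ lie in one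 two-sided cell $\mathcal J$ (the small cell), and $\mathcal J$ is finite if and only if the following three conditions hold: (a) $\Gamma$ is a tree; (b) $\Gamma$ has at most one labeled edge; (c) all labels of $\Gamma$ are finite. -/

import Mathlib

open scoped LaurentPolynomial

noncomputable section

namespace CoxeterMatrix

variable {B : Type*} (M : CoxeterMatrix B)

/-! ### The Coxeter-Dynkin diagram -/

/-- A Coxeter matrix is indecomposable if its index set is non-empty and cannot be split into two
non-empty parts such that `M i j = 2` whenever `i` and `j` lie in different parts (that is, the
Coxeter system is non-trivial and is not a product of two non-trivial parabolic subsystems). -/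
def IsIndecomposable : Prop :=
  Nonempty B ∧ ∀ I : Set B, (∀ i ∈ I, ∀ j ∉ I, M i j = 2) → I = ∅ ∨ I = Set.univ

/-- The graph underlying the Coxeter-Dynkin diagram: distinct `i`, `j` are joined by an edge if
and only if `M i j ≠ 2`. -/
def diagram : SimpleGraph B where
  Adj i j := i ≠ j ∧ M i j ≠ 2
  symm := ⟨fun i j h => ⟨h.1.symm, by rw [M.symmetric]; exact h.2⟩⟩
  loopless := ⟨fun _ h => h.1 rfl⟩

/-- The labeling function of the diagram. In Mathlib the entry `M i j = 0` stands for `∞`, so on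
edges it takes values in `{3, 4, …, ∞}`. -/
def label : Sym2 B → ℕ∞ :=
  Sym2.lift ⟨fun i j => if M i j = 0 then ⊤ else (M i j : ℕ∞), fun i j => by
    simp only [M.symmetric i j]⟩

/-- The labeled edges: those whose label is not `3`. -/
def labeledEdges : Set (Sym2 B) := {e | e ∈ M.diagram.edgeSet ∧ M.label e ≠ 3}

/-! ### The Hecke algebra

It is defined over `ℤ[v, v⁻¹]` (written `ℤ[T;T⁻¹]`, with `v = T 1`), in the normalization
`H_s ^ 2 = 1 + (v⁻¹ - v) H_s`. -/

/-- The defining relations of the Hecke algebra: quadratic relations and braid relations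
`H_i H_j H_i ⋯ = H_j H_i H_j ⋯` with `M i j` factors on both sides (no relation, i.e. `1 = 1`, if
`M i j` is infinite, encoded as `0`). -/
inductive HeckeRel : FreeAlgebra ℤ[T;T⁻¹] B → FreeAlgebra ℤ[T;T⁻¹] B → Prop
  | quadratic (i : B) :
      HeckeRel (FreeAlgebra.ι _ i * FreeAlgebra.ι _ i)
        (1 + (LaurentPolynomial.T (-1) - LaurentPolynomial.T 1 : ℤ[T;T⁻¹]) • FreeAlgebra.ι _ i)
  | braid (i j : B) :
      HeckeRel ((CoxeterSystem.alternatingWord i j (M i j)).map (FreeAlgebra.ι _)).prod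
        ((CoxeterSystem.alternatingWord j i (M i j)).map (FreeAlgebra.ι _)).prod

/-- The Hecke algebra over `ℤ[v, v⁻¹]`. -/
def Hecke : Type _ := RingQuot M.HeckeRel

instance : Ring M.Hecke := inferInstanceAs (Ring (RingQuot M.HeckeRel))

instance : Algebra ℤ[T;T⁻¹] M.Hecke := inferInstanceAs (Algebra _ (RingQuot M.HeckeRel))

/-- The quotient map from the free algebra. -/
def heckeMk : FreeAlgebra ℤ[T;T⁻¹] B →ₐ[ℤ[T;T⁻¹]] M.Hecke := RingQuot.mkAlgHom _ M.HeckeRel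

/-- The generator `H_s` of the Hecke algebra attached to `s = s_i`. -/
def heckeGen (i : B) : M.Hecke := M.heckeMk (FreeAlgebra.ι _ i)

theorem heckeGen_mul_self (i : B) :
    M.heckeGen i * M.heckeGen i =
      1 + (LaurentPolynomial.T (-1) - LaurentPolynomial.T 1 : ℤ[T;T⁻¹]) • M.heckeGen i := by
  have h := RingQuot.mkAlgHom_rel ℤ[T;T⁻¹] (HeckeRel.quadratic (M := M) i)
  have h' : M.heckeMk _ = M.heckeMk _ := h
  simpa only [map_mul, map_add, map_one, map_smul, ← heckeGen.eq_def] using h'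

theorem heckeGen_braid (i j : B) :
    ((CoxeterSystem.alternatingWord i j (M i j)).map M.heckeGen).prod =
      ((CoxeterSystem.alternatingWord j i (M i j)).map M.heckeGen).prod := by
  have h := RingQuot.mkAlgHom_rel ℤ[T;T⁻¹] (HeckeRel.braid (M := M) i j)
  have h' : M.heckeMk _ = M.heckeMk _ := h
  simp only [map_list_prod, List.map_map] at h'
  exact h'

/-- The element `H_s + (v - v⁻¹)`, which is the inverse of `H_s`. -/
def heckeGenInv (i : B) : M.Hecke :=
  M.heckeGen i + algebraMap ℤ[T;T⁻¹] M.Hecke (LaurentPolynomial.T 1 - LaurentPolynomial.T (-1))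

theorem heckeGen_mul_heckeGenInv (i : B) : M.heckeGen i * M.heckeGenInv i = 1 := by
  rw [heckeGenInv, mul_add, heckeGen_mul_self, ← Algebra.commutes, ← Algebra.smul_def, add_assoc,
    ← add_smul]
  simp

theorem heckeGenInv_mul_heckeGen (i : B) : M.heckeGenInv i * M.heckeGen i = 1 := by
  rw [heckeGenInv, add_mul, heckeGen_mul_self, ← Algebra.smul_def, add_assoc, ← add_smul]
  simp

theorem heckeInv_prod_mul (l : List B) :
    (l.map M.heckeGenInv).prod * (l.reverse.map M.heckeGen).prod = 1 := by
  induction l with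
  | nil => simp
  | cons a l ih =>
    simp only [List.map_cons, List.prod_cons, List.reverse_cons, List.map_append, List.prod_append,
      List.map_nil, List.prod_nil, mul_one]
    rw [mul_assoc, ← mul_assoc (List.map M.heckeGenInv l).prod, ih, one_mul,
      heckeGenInv_mul_heckeGen]

theorem hecke_prod_mul_inv (l : List B) :
    (l.reverse.map M.heckeGen).prod * (l.map M.heckeGenInv).prod = 1 := by
  induction l with
  | nil => simp
  | cons a l ih =>
    simp only [List.map_cons, List.prod_cons, List.reverse_cons, List.map_append, List.prod_append,
      List.map_nil, List.prod_nil, mul_one]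
    rw [mul_assoc, ← mul_assoc (M.heckeGen a), heckeGen_mul_heckeGenInv, one_mul, ih]

theorem reverse_alternatingWord (i j : B) (m : ℕ) :
    (CoxeterSystem.alternatingWord i j m).reverse =
      if Even m then CoxeterSystem.alternatingWord j i m
      else CoxeterSystem.alternatingWord i j m := by
  induction m generalizing i j with
  | zero => simp [CoxeterSystem.alternatingWord]
  | succ m ih =>
    rw [CoxeterSystem.alternatingWord_succ, List.concat_eq_append, List.reverse_append, ih,
      CoxeterSystem.alternatingWord_succ' j i, ← List.concat_eq_append,
      ← CoxeterSystem.alternatingWord_succ, CoxeterSystem.alternatingWord_succ' i j]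
    by_cases h : Even m <;> simp [h, Nat.even_add_one]

theorem heckeGenInv_braid (i j : B) :
    ((CoxeterSystem.alternatingWord i j (M i j)).map M.heckeGenInv).prod =
      ((CoxeterSystem.alternatingWord j i (M i j)).map M.heckeGenInv).prod := by
  have h : ((CoxeterSystem.alternatingWord i j (M i j)).reverse.map M.heckeGen).prod =
      ((CoxeterSystem.alternatingWord j i (M i j)).reverse.map M.heckeGen).prod := by
    rw [reverse_alternatingWord, reverse_alternatingWord]
    split_ifs
    · exact (M.heckeGen_braid i j).symm
    · exact M.heckeGen_braid i j
  refine left_inv_eq_right_inv (M.heckeInv_prod_mul _) ?_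
  rw [h]
  exact M.hecke_prod_mul_inv _

/-- The ring homomorphism `v ↦ v⁻¹` from `ℤ[v, v⁻¹]` to the (centre of the) Hecke algebra. -/
def heckeInvertScalar : ℤ[T;T⁻¹] →+* M.Hecke :=
  (algebraMap ℤ[T;T⁻¹] M.Hecke).comp (LaurentPolynomial.invert (R := ℤ)).toRingEquiv.toRingHom

/-- The algebra structure on the Hecke algebra in which `v` acts as `v⁻¹`. -/
abbrev heckeTwistedAlgebra : Algebra ℤ[T;T⁻¹] M.Hecke :=
  M.heckeInvertScalar.toAlgebra' fun r x =>
    Algebra.commutes (A := M.Hecke) (LaurentPolynomial.invert r) x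

/-- The bar involution on the free algebra, with values in the Hecke algebra: the ring
homomorphism with `v ↦ v⁻¹` and `H_s ↦ H_s⁻¹`. -/
def heckeBarAux : FreeAlgebra ℤ[T;T⁻¹] B →+* M.Hecke :=
  letI : Algebra ℤ[T;T⁻¹] M.Hecke := M.heckeTwistedAlgebra
  (FreeAlgebra.lift ℤ[T;T⁻¹] M.heckeGenInv).toRingHom

theorem heckeBarAux_ι (i : B) : M.heckeBarAux (FreeAlgebra.ι _ i) = M.heckeGenInv i := by
  letI : Algebra ℤ[T;T⁻¹] M.Hecke := M.heckeTwistedAlgebra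
  exact FreeAlgebra.lift_ι_apply (R := ℤ[T;T⁻¹]) M.heckeGenInv i

theorem heckeBarAux_algebraMap (r : ℤ[T;T⁻¹]) :
    M.heckeBarAux (algebraMap _ _ r) =
      algebraMap ℤ[T;T⁻¹] M.Hecke (LaurentPolynomial.invert r) := by
  letI : Algebra ℤ[T;T⁻¹] M.Hecke := M.heckeTwistedAlgebra
  exact (FreeAlgebra.lift ℤ[T;T⁻¹] M.heckeGenInv).commutes r

theorem heckeBarAux_rel ⦃x y : FreeAlgebra ℤ[T;T⁻¹] B⦄ (h : M.HeckeRel x y) :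
    M.heckeBarAux x = M.heckeBarAux y := by
  cases h with
  | quadratic i =>
    rw [Algebra.smul_def]
    simp only [map_mul, map_add, map_one, heckeBarAux_ι, heckeBarAux_algebraMap, map_sub,
      LaurentPolynomial.invert_T, neg_neg]
    have h : M.heckeGenInv i * M.heckeGenInv i = M.heckeGen i * M.heckeGenInv i +
        algebraMap ℤ[T;T⁻¹] M.Hecke (LaurentPolynomial.T 1 - LaurentPolynomial.T (-1)) *
          M.heckeGenInv i := by
      rw [← add_mul]; rfl
    rw [h, heckeGen_mul_heckeGenInv, map_sub]
  | braid i j =>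
    simp only [map_list_prod, List.map_map]
    have : (M.heckeBarAux ∘ FreeAlgebra.ι ℤ[T;T⁻¹]) = M.heckeGenInv :=
      funext fun i => M.heckeBarAux_ι i
    rw [this]
    exact M.heckeGenInv_braid i j

/-- The bar involution: the ring homomorphism with `v ↦ v⁻¹` and `H_s ↦ H_s⁻¹`. -/
def heckeBar : M.Hecke →+* M.Hecke :=
  RingQuot.lift ⟨M.heckeBarAux, M.heckeBarAux_rel⟩

theorem heckeBar_heckeMk (x : FreeAlgebra ℤ[T;T⁻¹] B) :
    M.heckeBar (M.heckeMk x) = M.heckeBarAux x := by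
  have h : M.heckeMk x = RingQuot.mkRingHom M.HeckeRel x :=
    congrArg (fun f : FreeAlgebra ℤ[T;T⁻¹] B →+* RingQuot M.HeckeRel => f x)
      (RingQuot.mkAlgHom_coe ℤ[T;T⁻¹] M.HeckeRel)
  rw [h]
  exact RingQuot.lift_mkRingHom_apply M.heckeBarAux M.heckeBarAux_rel x

theorem heckeBar_heckeGen (i : B) : M.heckeBar (M.heckeGen i) = M.heckeGenInv i := by
  rw [heckeGen, heckeBar_heckeMk, heckeBarAux_ι]

theorem heckeBar_algebraMap (r : ℤ[T;T⁻¹]) :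
    M.heckeBar (algebraMap _ _ r) =
      algebraMap ℤ[T;T⁻¹] M.Hecke (LaurentPolynomial.invert r) := by
  rw [← M.heckeMk.commutes, heckeBar_heckeMk, heckeBarAux_algebraMap]

end CoxeterMatrix

namespace CoxeterSystem

variable {B W : Type*} [Group W] {M : CoxeterMatrix B} (cs : CoxeterSystem M W)

/-! ### The Kazhdan-Lusztig basis -/

/-- The standard basis element `H_w = H_{s_1} ⋯ H_{s_k}`, where `w = s_1 ⋯ s_k` is a reduced
expression (the product does not depend on it, since any two reduced expressions are related by
braid moves). -/
def heckeStd (w : W) : M.Hecke :=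
  ((cs.exists_isReduced w).choose.map M.heckeGen).prod

/-- The characterization of the Kazhdan-Lusztig basis element of `w`: it is fixed by the bar
involution and lies in `H_w + ∑_y v ℤ[v] H_y`. -/
def IsKLElement (w : W) (c : M.Hecke) : Prop :=
  M.heckeBar c = c ∧
    ∃ p : W →₀ Polynomial ℤ,
      c = cs.heckeStd w +
        p.sum fun y q => (LaurentPolynomial.T 1 * Polynomial.toLaurent q) • cs.heckeStd y

/-- The Kazhdan-Lusztig basis element of `w`: the element characterized by `IsKLElement` (by the
theorem of Kazhdan and Lusztig there is exactly one). -/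
def klBasis (w : W) : M.Hecke := Classical.epsilon (cs.IsKLElement w)

/-- The Kazhdan-Lusztig basis element of `y` appears with a non-zero coefficient in the expansion
of `h` in the Kazhdan-Lusztig basis. -/
def AppearsIn (y : W) (h : M.Hecke) : Prop :=
  ∃ f : W →₀ ℤ[T;T⁻¹], h = (f.sum fun z a => a • cs.klBasis z) ∧ f y ≠ 0

/-! ### Two-sided cells -/

/-- The two-sided Kazhdan-Lusztig preorder: the preorder generated by the relations between `x`
and `y` such that the basis element of `y` appears in the product `C_a * C_x * C_b` for some
`a`, `b`, where `C` is the Kazhdan-Lusztig basis. -/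
def TwoSidedLE : W → W → Prop :=
  Relation.ReflTransGen fun x y =>
    ∃ a b : W, cs.AppearsIn y (cs.klBasis a * cs.klBasis x * cs.klBasis b)

/-- A two-sided cell is an equivalence class for the two-sided preorder. -/
def IsTwoSidedCell (J : Set W) : Prop :=
  ∃ x : W, J = {y | cs.TwoSidedLE x y ∧ cs.TwoSidedLE y x}

/-- The small cell: the elements that lie in the two-sided cell of a simple reflection. (For an
indecomposable system this is a single two-sided cell.) -/
def smallCell : Set W :=
  {w | ∃ i : B, cs.TwoSidedLE (cs.simple i) w ∧ cs.TwoSidedLE w (cs.simple i)}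

end CoxeterSystem

end

/-! The small cell is the set of elements `w ≠ 1` with exactly one reduced expression
(`smallCell_eq`), so its finiteness is a question about words.

Write `C_w` for the Kazhdan-Lusztig basis and `μ(z, w)` for the coefficient of `v` at `H_z` in
`C_w`. If `s_i w > w`, then `C_i C_w = C_{s_i w} + ∑ μ(z, w) C_z`, over `z` shorter than `w` with
left descent `i`. The key fact (`coeff_one_repr_klBasis`) is that `μ(y, w)` is `1` or `0` according
as `s_r y = w` or not, whenever `r` is a left descent of `w` but not of `y`. Hence the elements with
several reduced expressions are stable under multiplication and inversion, so nothing below a simple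
reflection lies among them. Conversely, if `w` has the unique reduced word `i j ⋯`, the key fact
makes `C_{s_i w}` appear in `C_j C_w`; removing letters one at a time links `w` to a simple
reflection. Adjacent vertices of the diagram give equivalent reflections, and the diagram is
connected.

By Matsumoto's exchange argument, unique reduced words are the rigid words: those without a factor
`i i` or a full braid word. They are walks in the diagram that may turn back only on an edge with
label at least `4`. An infinite label, a cycle, or two labeled edges each allow an endless rigid
walk. In a finite tree with at most one labeled edge, a walk that never turns back is a path, so a
long rigid walk must end up alternating along the labeled edge, for fewer steps than its label
(`finite_isRigid_iff`). -/

open scoped LaurentPolynomial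

noncomputable section

namespace CoxeterMatrix

variable {B : Type*} (M : CoxeterMatrix B)

/-! ### The geometric representation -/

/-- The coroot functional of the geometric representation. -/
def coroot (i : B) : Module.Dual ℝ (B →₀ ℝ) :=
  Finsupp.linearCombination ℝ fun j => -2 * Real.cos (Real.pi / M i j)

theorem coroot_single (i j : B) :
    M.coroot i (Finsupp.single j 1) = -2 * Real.cos (Real.pi / M i j) := by
  simp [coroot]

theorem coroot_self (i : B) : M.coroot i (Finsupp.single i 1) = 2 := by
  simp [coroot_single]

/-- The reflection attached to a simple root in the geometric representation. -/
def geomRefl (i : B) : (B →₀ ℝ) ≃ₗ[ℝ] (B →₀ ℝ) := Module.reflection (M.coroot_self i)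

/-- Powers of `s_i s_j` are expressed by `S_n(2 cos θ) = sin((n + 1)θ) / sin θ` with `θ = 2π / m`.
In the `m`-th power the correction terms contain the factor `S_{p-1}` if `m = 2p`, and `S_p +
S_{p-1}` if `m = 2p + 1`; both vanish. -/
theorem geomRefl_liftable : M.IsLiftable M.geomRefl := by
  intro i j
  ext1 z
  rcases eq_or_ne i j with rfl | hij
  · simp only [M.diagonal, pow_one]
    exact Module.involutive_reflection (M.coroot_self i) z
  have h1 : M i j ≠ 1 := M.off_diagonal i j hij
  rcases eq_or_ne (M i j) 0 with h0 | h0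
  · simp [h0]
  have key := Module.reflection_mul_reflection_pow_apply (M.coroot_self i) (M.coroot_self j)
    (M i j) z
  rw [geomRefl, geomRefl, key, LinearEquiv.coe_one, id]
  simp only [coroot_single, M.symmetric j i]
  obtain ⟨m, hm⟩ : ∃ m, m = M i j := ⟨_, rfl⟩
  rw [← hm] at h0 h1 ⊢
  -- Here `θ = π` and `sin θ = 0`, so the quotient formula for `S_n` says nothing.
  rcases eq_or_ne m 2 with rfl | h2
  · norm_num [Polynomial.Chebyshev.S_neg_one]
    module
  have hm3 : 3 ≤ m := by omega
  have hm0 : (0 : ℝ) < m := by positivity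
  set θ : ℝ := 2 * (Real.pi / m) with hθ
  have ht : -2 * Real.cos (Real.pi / m) * (-2 * Real.cos (Real.pi / m)) - 2 = 2 * Real.cos θ := by
    rw [hθ, Real.cos_two_mul]; ring
  rw [ht]
  have hs : Real.sin θ ≠ 0 := by
    refine (Real.sin_pos_of_pos_of_lt_pi (by positivity) ?_).ne'
    have : (3 : ℝ) ≤ m := by exact_mod_cast hm3
    have hp := Real.pi_pos
    rw [hθ, ← mul_div_assoc, div_lt_iff₀ hm0]
    nlinarith
  have hS := fun n : ℤ => Polynomial.Chebyshev.S_two_mul_real_cos θ n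
  have hmθ : (m : ℝ) * θ = 2 * Real.pi := by rw [hθ]; field_simp
  rcases Nat.even_or_odd' m with ⟨p, rfl | rfl⟩
  · have e1 : (((2 * p : ℕ) : ℤ) - 2) / 2 = p - 1 := by omega
    have e2 : (((2 * p : ℕ) : ℤ) - 1) / 2 = p - 1 := by omega
    have : (Polynomial.Chebyshev.S ℝ (p - 1)).eval (2 * Real.cos θ) = 0 := by
      have := hS (p - 1)
      have e : (((p : ℤ) - 1 : ℤ) + 1 : ℝ) * θ = Real.pi := by
        push_cast at hmθ ⊢; linarith
      rw [e, Real.sin_pi] at this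
      exact (mul_eq_zero.mp this).resolve_right hs
    rw [e1, e2, this]
    simp
  · have e1 : (((2 * p + 1 : ℕ) : ℤ) - 2) / 2 = p - 1 := by omega
    have e2 : (((2 * p + 1 : ℕ) : ℤ) - 1) / 2 = p := by omega
    have e3 : (((2 * p + 1 : ℕ) : ℤ) - 3) / 2 = p - 1 := by omega
    have e4 : (((2 * p + 1 : ℕ) : ℤ)) / 2 = p := by omega
    have : (Polynomial.Chebyshev.S ℝ p).eval (2 * Real.cos θ) +
        (Polynomial.Chebyshev.S ℝ (p - 1)).eval (2 * Real.cos θ) = 0 := by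
      refine (mul_eq_zero.mp ?_).resolve_right hs
      rw [add_mul, hS, hS]
      have e : (((p : ℤ) - 1 : ℤ) + 1 : ℝ) * θ = 2 * Real.pi - ((p : ℤ) + 1 : ℝ) * θ := by
        push_cast at hmθ ⊢; linarith
      rw [e, Real.sin_two_pi_sub]
      ring
    rw [e1, e2, e3, e4, this]
    simp

/-- The `k`-th power is evaluated on the root `e_i`: the two coordinates give `S_{k-1} = 0` and `S_k
= 1`, hence `cos(kθ) = 1`. This shows that dihedral subgroups do not collapse. -/
theorem dvd_of_geomRefl_pow {i j : B} (hij : i ≠ j) {k : ℕ}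
    (h : (M.geomRefl i * M.geomRefl j) ^ k = 1) : M i j ∣ k := by
  have h1 : M i j ≠ 1 := M.off_diagonal i j hij
  have key := Module.reflection_mul_reflection_pow_apply_self (M.coroot_self i) (M.coroot_self j) k
  change ((M.geomRefl i * M.geomRefl j) ^ k) _ = _ at key
  rw [h, LinearEquiv.coe_one, id] at key
  simp only [coroot_single, M.symmetric j i] at key
  have ki := DFunLike.congr_fun key i
  have kj := DFunLike.congr_fun key j
  simp [hij, hij.symm] at ki kj
  obtain ⟨m, hm⟩ : ∃ m, m = M i j := ⟨_, rfl⟩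
  rw [← hm] at h1 ki kj ⊢
  -- An infinite label gives `π / 0 = 0`, so the cosine is `1`, the argument is `2`, and `S_{k-1}(2)
  -- = k`.
  rcases eq_or_ne m 0 with rfl | h0
  · norm_num [Polynomial.Chebyshev.S_eval_two] at kj ki
    simp [kj]
  rcases eq_or_ne m 2 with rfl | h2
  · norm_num [Polynomial.Chebyshev.S_eval_neg_two] at ki
    rw [← even_iff_two_dvd]
    by_contra hk
    obtain ⟨n, rfl⟩ := Nat.not_even_iff_odd.mp hk
    have e : (((2 * n + 1 : ℕ) : ℤ) - 1).natAbs = 2 * n := by omega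
    rw [e, pow_succ, pow_mul] at ki
    norm_num at ki
    linarith
  have hm3 : 3 ≤ m := by omega
  have hm0 : (0 : ℝ) < m := by positivity
  have hm3' : (3 : ℝ) ≤ m := by exact_mod_cast hm3
  have hp := Real.pi_pos
  have hc : Real.cos (Real.pi / m) ≠ 0 := by
    refine (Real.cos_pos_of_mem_Ioo ⟨?_, ?_⟩).ne'
    · have : 0 < Real.pi / m := by positivity
      linarith
    · rw [div_lt_div_iff₀ hm0 (by norm_num)]
      nlinarith
  have kj := kj.resolve_right hc
  rw [kj, add_zero] at ki
  set θ : ℝ := 2 * (Real.pi / m) with hθ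
  have ht : 2 * Real.cos (Real.pi / m) * (2 * Real.cos (Real.pi / m)) - 2 = 2 * Real.cos θ := by
    rw [hθ, Real.cos_two_mul]; ring
  rw [ht] at ki kj
  have hs : Real.sin θ ≠ 0 := by
    refine (Real.sin_pos_of_pos_of_lt_pi (by positivity) ?_).ne'
    rw [hθ, ← mul_div_assoc, div_lt_iff₀ hm0]
    nlinarith
  have a1 := Polynomial.Chebyshev.S_two_mul_real_cos θ k
  have a2 := Polynomial.Chebyshev.S_two_mul_real_cos θ (k - 1)
  rw [← ki] at a1
  rw [kj] at a2
  push_cast at a1 a2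
  rw [sub_add_cancel, zero_mul] at a2
  rw [one_mul, add_mul, one_mul, Real.sin_add, ← a2, zero_mul, zero_add] at a1
  have a3 : Real.cos (k * θ) = 1 := by
    have : (Real.cos (k * θ) - 1) * Real.sin θ = 0 := by linarith
    linarith [(mul_eq_zero.mp this).resolve_right hs]
  obtain ⟨n, hn⟩ := (Real.cos_eq_one_iff _).mp a3
  have : (n : ℝ) * m = k := by
    rw [hθ] at hn
    field_simp at hn
    exact hn
  have h' : n * (m : ℤ) = k := by exact_mod_cast this
  exact Int.natCast_dvd_natCast.mp ⟨n, by rw [← h', mul_comm]⟩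

end CoxeterMatrix

/-! ### Parity of inversions and the exchange property -/

namespace CoxeterSystem

variable {B W : Type*} [Group W] {M : CoxeterMatrix B} (cs : CoxeterSystem M W)

theorem dvd_of_simple_mul_simple_pow {i j : B} (hij : i ≠ j) {k : ℕ}
    (h : (cs.simple i * cs.simple j) ^ k = 1) : M i j ∣ k := by
  apply M.dvd_of_geomRefl_pow hij
  have := congrArg (cs.lift ⟨M.geomRefl, M.geomRefl_liftable⟩) h
  simpa [cs.lift_apply_simple M.geomRefl_liftable] using this

theorem simple_injective : Function.Injective cs.simple := by
  intro i j h
  by_contra hij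
  have := cs.dvd_of_simple_mul_simple_pow hij (k := 1) (by simp [h])
  exact M.off_diagonal i j hij (Nat.dvd_one.mp this)

/-- The permutation of `W × ℤ/2` attached to a simple reflection; it records the parity of the
number of times an element occurs in a right inversion sequence. -/
def parityPerm (i : B) : Equiv.Perm (W × ZMod 2) :=
  letI := Classical.decEq W
  Function.Involutive.toPerm
    (fun x => (cs.simple i * x.1 * cs.simple i, x.2 + if x.1 = cs.simple i then 1 else 0)) <| by
    rintro ⟨t, e⟩
    have h : cs.simple i * t * cs.simple i = cs.simple i ↔ t = cs.simple i := by
      constructor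
      · intro h
        have := congrArg (fun x => cs.simple i * x * cs.simple i) h
        simpa [mul_assoc] using this
      · rintro rfl; simp
    ext1
    · simp [mul_assoc]
    · simp only [h]
      split_ifs
      · rw [add_assoc, show (1 : ZMod 2) + 1 = 0 from rfl, add_zero]
      · simp

theorem parityPerm_apply [DecidableEq W] (i : B) (x : W × ZMod 2) :
    cs.parityPerm i x =
      (cs.simple i * x.1 * cs.simple i, x.2 + if x.1 = cs.simple i then 1 else 0) := by
  change ((cs.simple i * x.1 * cs.simple i,
    x.2 + @ite _ (x.1 = cs.simple i) (Classical.decEq W _ _) 1 0) : W × ZMod 2) = _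
  congr

theorem prod_map_parityPerm_apply [DecidableEq W] (ω : List B) (x : W × ZMod 2) :
    (ω.map cs.parityPerm).prod x =
      (cs.wordProd ω * x.1 * (cs.wordProd ω)⁻¹, x.2 + (cs.rightInvSeq ω).count x.1) := by
  induction ω with
  | nil => simp
  | cons i ω ih =>
    rw [List.map_cons, List.prod_cons, Equiv.Perm.mul_apply, ih, rightInvSeq, List.count_cons,
      wordProd_cons]
    have h : cs.wordProd ω * x.1 * (cs.wordProd ω)⁻¹ = cs.simple i ↔
        (cs.wordProd ω)⁻¹ * cs.simple i * cs.wordProd ω = x.1 := by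
      rw [mul_inv_eq_iff_eq_mul, ← eq_inv_mul_iff_mul_eq, ← mul_assoc, eq_comm]
    simp only [parityPerm_apply, h, beq_iff_eq]
    ext1
    · simp [mul_assoc]
    · simp only
      split_ifs <;> push_cast <;> ring

/-- The inversions are the alternating words of odd length `2k + 1`; as a function of `k` they have
period `p`, so the second half of the list repeats the first. -/
theorem even_count_leftInvSeq_alternatingWord [DecidableEq W] {i j : B} {p : ℕ}
    (hp : (cs.simple j * cs.simple i) ^ p = 1) (t : W) :
    Even ((cs.leftInvSeq (alternatingWord i j (2 * p))).count t) := by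
  have h : cs.leftInvSeq (alternatingWord i j (2 * p)) =
      (List.range (2 * p)).map fun k => cs.wordProd (alternatingWord j i (2 * k + 1)) := by
    apply List.ext_getElem
    · simp
    · intro k h1 h2
      rw [cs.getElem_leftInvSeq_alternatingWord i j _ k (by simpa using h1)]
      simp
  rw [h, two_mul, List.range_add, List.map_append, List.count_append, List.map_map]
  have h' : ((fun k => cs.wordProd (alternatingWord j i (2 * k + 1))) ∘ fun x => p + x) =
      fun k => cs.wordProd (alternatingWord j i (2 * k + 1)) := by
    funext k
    simp only [Function.comp, prod_alternatingWord_eq_mul_pow]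
    have e1 : (2 * (p + k) + 1) / 2 = p + k := by omega
    have e2 : (2 * k + 1) / 2 = k := by omega
    rw [e1, e2, pow_add, hp]
    simp [parity_simps]
  rw [h']
  exact ⟨_, rfl⟩

theorem parityPerm_liftable : M.IsLiftable cs.parityPerm := by
  classical
  intro i j
  have h : ∀ p, (cs.parityPerm i * cs.parityPerm j) ^ p =
      ((alternatingWord i j (2 * p)).map cs.parityPerm).prod := by
    intro p
    induction p with
    | zero => simp [alternatingWord]
    | succ p ih =>
      rw [show 2 * (p + 1) = 2 * p + 1 + 1 by ring, alternatingWord_succ, alternatingWord_succ,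
        pow_succ, ih]
      simp
  have hr : (alternatingWord i j (2 * M i j)).reverse = alternatingWord j i (2 * M i j) := by
    rw [CoxeterMatrix.reverse_alternatingWord, if_pos (even_two_mul _)]
  rw [h]
  ext1 x
  rw [prod_map_parityPerm_apply, ← List.count_reverse, ← leftInvSeq_reverse, hr,
    ZMod.natCast_eq_zero_iff_even.mpr
      (cs.even_count_leftInvSeq_alternatingWord (cs.simple_mul_simple_pow i j) x.1),
    prod_alternatingWord_eq_mul_pow]
  simp

/-- The signed permutations `parityPerm` satisfy the Coxeter relations, so the permutation of a
word, and with it the parity, depends only on the group element. -/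
theorem count_rightInvSeq_congr [DecidableEq W] {ω ω' : List B}
    (h : cs.wordProd ω = cs.wordProd ω') (t : W) :
    ((cs.rightInvSeq ω).count t : ZMod 2) = (cs.rightInvSeq ω').count t := by
  have key : ∀ ω : List B, cs.lift ⟨_, cs.parityPerm_liftable⟩ (cs.wordProd ω) =
      (ω.map cs.parityPerm).prod := by
    intro ω
    rw [wordProd, map_list_prod, List.map_map]
    congr 2
    funext i
    exact cs.lift_apply_simple cs.parityPerm_liftable i
  have := congrArg (fun f => (f (t, 0)).2) ((key ω).symm.trans ((congrArg _ h).trans (key ω')))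
  simpa [prod_map_parityPerm_apply] using this

/-- Compare with a reduced word ending in `i`, in whose inversion sequence `s_i` occurs exactly
once: its count in `ω` is odd. -/
theorem mem_rightInvSeq_of_isRightDescent {ω : List B} {i : B}
    (h : cs.IsRightDescent (cs.wordProd ω) i) : cs.simple i ∈ cs.rightInvSeq ω := by
  classical
  obtain ⟨τ, hτ, hτ'⟩ := cs.exists_isReduced (cs.wordProd ω * cs.simple i)
  have hτi : cs.wordProd (τ.concat i) = cs.wordProd ω := by
    rw [wordProd_concat, ← hτ']; simp
  have hred : cs.IsReduced (τ.concat i) := by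
    have := (cs.isRightDescent_iff).mp h
    rw [IsReduced, hτi, ← this, hτ', hτ.eq]; simp
  have hmem : cs.simple i ∈ cs.rightInvSeq (τ.concat i) := by rw [rightInvSeq_concat]; simp
  have hc := cs.count_rightInvSeq_congr hτi (cs.simple i)
  rw [List.count_eq_one_of_mem hred.nodup_rightInvSeq hmem] at hc
  by_contra hn
  rw [List.count_eq_zero_of_not_mem hn] at hc
  simp at hc

/-- The exchange property. -/
theorem exists_eraseIdx_of_isLeftDescent {ω : List B} {i : B}
    (h : cs.IsLeftDescent (cs.wordProd ω) i) :
    ∃ j < ω.length, cs.simple i * cs.wordProd ω = cs.wordProd (ω.eraseIdx j) := by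
  rw [← isRightDescent_inv_iff, ← wordProd_reverse] at h
  have := cs.mem_rightInvSeq_of_isRightDescent h
  rw [rightInvSeq_reverse, List.mem_reverse] at this
  obtain ⟨j, hj, hj'⟩ := List.getElem_of_mem this
  refine ⟨j, by simpa using hj, ?_⟩
  rw [← getD_leftInvSeq_mul_wordProd, List.getD_eq_getElem _ _ hj, hj']

end CoxeterSystem

namespace CoxeterSystem

/-! ### Dihedral words and Matsumoto's theorem -/

/-- The word of length `n` that alternates between `i` and `j`, starting with `i`. -/
def altFrom {B : Type*} (i j : B) : ℕ → List B
  | 0 => []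
  | n + 1 => i :: altFrom j i n

section

variable {B : Type*}

@[simp] theorem length_altFrom (i j : B) (n : ℕ) : (altFrom i j n).length = n := by
  induction n generalizing i j with
  | zero => rfl
  | succ n ih => simp [altFrom, ih]

theorem altFrom_eq_reverse (i j : B) (n : ℕ) : altFrom i j n = (alternatingWord j i n).reverse := by
  induction n generalizing i j with
  | zero => rfl
  | succ n ih => rw [altFrom, ih, alternatingWord_succ]; simp

theorem mem_altFrom {i j b : B} {n : ℕ} (h : b ∈ altFrom i j n) : b = i ∨ b = j := by
  induction n generalizing i j with
  | zero => simp [altFrom] at h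
  | succ n ih =>
    rcases List.mem_cons.mp h with h | h
    · exact Or.inl h
    · exact (ih h).symm

theorem getElem_altFrom (i j : B) (n k : ℕ) (h : k < (altFrom i j n).length) :
    (altFrom i j n)[k] = if Even k then i else j := by
  induction n generalizing i j k with
  | zero => simp at h
  | succ n ih =>
    cases k with
    | zero => simp [altFrom]
    | succ k => simp only [altFrom, List.getElem_cons_succ, ih, Nat.even_add_one]; split_ifs <;> rfl

theorem prod_map_altFrom_comm {G : Type*} [Monoid G] {M : CoxeterMatrix B} {f : B → G}
    (hf : ∀ i j, ((alternatingWord i j (M i j)).map f).prod =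
      ((alternatingWord j i (M i j)).map f).prod) (i j : B) :
    ((altFrom i j (M i j)).map f).prod = ((altFrom j i (M i j)).map f).prod := by
  rw [altFrom_eq_reverse, altFrom_eq_reverse, CoxeterMatrix.reverse_alternatingWord,
    CoxeterMatrix.reverse_alternatingWord]
  split_ifs
  · exact hf i j
  · exact (hf i j).symm

end

variable {B W : Type*} [Group W] {M : CoxeterMatrix B} (cs : CoxeterSystem M W)

theorem wordProd_altFrom_comm (i j : B) :
    cs.wordProd (altFrom i j (M i j)) = cs.wordProd (altFrom j i (M i j)) := by
  refine prod_map_altFrom_comm (M := M) (fun i j => ?_) i j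
  have := cs.wordProd_braidWord_eq i j
  rw [braidWord, braidWord, M.symmetric j i] at this
  exact this

theorem simple_mul_zpow (i j : B) (z : ℤ) :
    cs.simple i * (cs.simple i * cs.simple j) ^ z =
      (cs.simple i * cs.simple j) ^ (-z) * cs.simple i := by
  have h : SemiconjBy (cs.simple i) (cs.simple i * cs.simple j)
      (cs.simple i * cs.simple j)⁻¹ := by
    simp [SemiconjBy, mul_assoc]
  have := h.zpow_right z
  rw [inv_zpow, ← zpow_neg] at this
  exact this

theorem simple_mul_zpow' (i j : B) (z : ℤ) :
    cs.simple j * (cs.simple i * cs.simple j) ^ z =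
      (cs.simple i * cs.simple j) ^ (-z - 1) * cs.simple i := by
  have : cs.simple j = cs.simple i * (cs.simple i * cs.simple j) := by simp
  rw [show -z - 1 = -(1 + z) by ring, ← simple_mul_zpow, zpow_one_add, ← mul_assoc (cs.simple i),
    ← this]

/-- The integer `2z + ε` is a signed position on the infinite dihedral line; each letter moves its
absolute value by at most one. -/
theorem exists_wordProd_eq_zpow (i j : B) (τ : List B) (hτ : ∀ b ∈ τ, b = i ∨ b = j) :
    ∃ z : ℤ, cs.wordProd τ = (cs.simple i * cs.simple j) ^ z * cs.simple i ^ (τ.length % 2) ∧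
      |2 * z + (τ.length % 2 : ℕ)| ≤ τ.length := by
  induction τ with
  | nil => exact ⟨0, by simp, by simp⟩
  | cons b τ ih =>
    obtain ⟨z, hz, hz'⟩ := ih fun b hb => hτ b (List.mem_cons_of_mem _ hb)
    have hlen : (b :: τ).length = τ.length + 1 := rfl
    have hmod := Nat.mod_two_eq_zero_or_one τ.length
    have hs : cs.simple i * cs.simple i ^ (τ.length % 2) =
        cs.simple i ^ ((b :: τ).length % 2) := by
      rcases hmod with h | h
      · have : (b :: τ).length % 2 = 1 := by omega
        rw [h, this]; simp
      · have : (b :: τ).length % 2 = 0 := by omega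
        rw [h, this]; simp
    rw [abs_le] at hz'
    rcases hτ b List.mem_cons_self with rfl | rfl
    · refine ⟨-z, ?_, ?_⟩
      · rw [wordProd_cons, hz, ← mul_assoc, simple_mul_zpow, mul_assoc, hs]
      · rw [abs_le]; omega
    · refine ⟨-z - 1, ?_, ?_⟩
      · rw [wordProd_cons, hz, ← mul_assoc, simple_mul_zpow', mul_assoc, hs]
      · rw [abs_le]; omega

theorem wordProd_altFrom (i j : B) (n : ℕ) :
    cs.wordProd (altFrom i j n) =
      (cs.simple i * cs.simple j) ^ (n / 2 : ℤ) * cs.simple i ^ (n % 2) := by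
  induction n using Nat.twoStepInduction with
  | zero => simp [altFrom]
  | one => simp [altFrom]
  | more n ih _ =>
    have e : ((n + 2 : ℕ) : ℤ) / 2 = 1 + n / 2 := by omega
    rw [altFrom, altFrom, wordProd_cons, wordProd_cons, ih, e, zpow_one_add, Nat.add_mod_right]
    simp [mul_assoc]

/-- Equality would give `(s_i s_j) ^ d = 1` with `1 ≤ d ≤ k`, against the exact order of `s_i s_j`.
-/
theorem wordProd_altFrom_ne {i j : B} (hij : i ≠ j) {k : ℕ} (hk : M i j = 0 ∨ k < M i j)
    {τ : List B} (hτ : ∀ b ∈ τ, b = i ∨ b = j) (hlen : τ.length + 1 = k) :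
    cs.wordProd (altFrom i j (k + 1)) ≠ cs.wordProd τ := by
  intro h
  obtain ⟨z, hz, hz'⟩ := cs.exists_wordProd_eq_zpow i j τ hτ
  have e : τ.length % 2 = (k + 1) % 2 := by omega
  rw [hz, wordProd_altFrom, e, mul_left_inj] at h
  rw [abs_le] at hz'
  obtain ⟨d, hd⟩ : ∃ d : ℕ, (d : ℤ) = ((k + 1 : ℕ) : ℤ) / 2 - z :=
    ⟨(((k + 1 : ℕ) : ℤ) / 2 - z).toNat, by omega⟩
  have h1 : (cs.simple i * cs.simple j) ^ d = 1 := by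
    rw [← zpow_natCast, hd, zpow_sub, h, mul_inv_cancel]
  have h2 := cs.dvd_of_simple_mul_simple_pow hij h1
  rcases hk with hk | hk
  · rw [hk, zero_dvd_iff] at h2
    omega
  · have := Nat.le_of_dvd (by omega) h2
    omega

/-- Induction with `i` and `j` exchanged: prepending the other descent deletes a letter. By
`wordProd_altFrom_ne` this letter is not in the alternating prefix, which therefore grows by one. -/
theorem exists_isReduced_altFrom_append {w : W} {i j : B} (hij : i ≠ j)
    (hi : cs.IsLeftDescent w i) (hj : cs.IsLeftDescent w j) (k : ℕ)
    (hk : M i j = 0 ∨ k ≤ M i j) :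
    ∃ ω, cs.IsReduced (altFrom i j k ++ ω) ∧ cs.wordProd (altFrom i j k ++ ω) = w := by
  induction k generalizing i j with
  | zero =>
    obtain ⟨ω, h, h'⟩ := cs.exists_isReduced w
    exact ⟨ω, h, h'.symm⟩
  | succ k ih =>
    obtain ⟨ω, h, h'⟩ := ih hij.symm hj hi (by rw [M.symmetric]; omega)
    rw [← h'] at hi
    obtain ⟨p, hp, hp'⟩ := cs.exists_eraseIdx_of_isLeftDescent hi
    rcases lt_or_ge p k with hpk | hpk
    · exfalso
      rw [List.eraseIdx_append_of_lt_length (by simpa using hpk), wordProd_append, wordProd_append,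
        ← mul_assoc, mul_left_inj, ← wordProd_cons] at hp'
      refine cs.wordProd_altFrom_ne hij (by omega) (fun b hb => ?_) ?_ hp'
      · exact (mem_altFrom (List.mem_of_mem_eraseIdx hb)).symm
      · rw [List.length_eraseIdx_of_lt (by simpa using hpk)]
        simp only [length_altFrom]; omega
    · rw [List.eraseIdx_append_of_length_le (by simpa using hpk), h'] at hp'
      have hw : cs.wordProd (altFrom i j (k + 1) ++ ω.eraseIdx (p - (altFrom j i k).length)) = w := by
        rw [altFrom, List.cons_append, wordProd_cons, ← hp']; simp
      refine ⟨_, ?_, hw⟩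
      rw [IsReduced, hw, ← h', h.eq]
      simp only [List.length_append, length_altFrom] at hp ⊢
      rw [List.length_eraseIdx_of_lt (by omega)]
      omega

theorem entry_ne_zero_of_isLeftDescent {w : W} {i j : B} (hij : i ≠ j)
    (hi : cs.IsLeftDescent w i) (hj : cs.IsLeftDescent w j) : M i j ≠ 0 := by
  intro h0
  obtain ⟨ω, h, h'⟩ := cs.exists_isReduced_altFrom_append hij hi hj (cs.length w + 1) (Or.inl h0)
  have := h.eq
  rw [h'] at this
  simp at this
  omega

theorem exists_isReduced_braid {w : W} {i j : B} (hij : i ≠ j)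
    (hi : cs.IsLeftDescent w i) (hj : cs.IsLeftDescent w j) :
    ∃ ω, cs.IsReduced (altFrom i j (M i j) ++ ω) ∧ cs.wordProd (altFrom i j (M i j) ++ ω) = w ∧
      cs.IsReduced (altFrom j i (M i j) ++ ω) ∧ cs.wordProd (altFrom j i (M i j) ++ ω) = w := by
  obtain ⟨ω, h, h'⟩ := cs.exists_isReduced_altFrom_append hij hi hj (M i j) (Or.inr le_rfl)
  have hw : cs.wordProd (altFrom j i (M i j) ++ ω) = w := by
    rw [wordProd_append, ← wordProd_altFrom_comm, ← wordProd_append, h']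
  refine ⟨ω, h, h', ?_, hw⟩
  rw [IsReduced, hw, ← h', h.eq]
  simp

theorem IsReduced.of_cons {i : B} {ω : List B} (h : cs.IsReduced (i :: ω)) : cs.IsReduced ω :=
  h.drop 1

theorem IsReduced.isLeftDescent_cons {i : B} {ω : List B} (h : cs.IsReduced (i :: ω)) :
    cs.IsLeftDescent (cs.wordProd (i :: ω)) i := by
  rw [IsLeftDescent, h.eq, wordProd_cons, simple_mul_simple_cancel_left]
  exact (cs.length_wordProd_le ω).trans_lt (by simp)

/-- Matsumoto's theorem. -/
theorem prod_map_eq_of_isReduced {G : Type*} [Monoid G] {f : B → G}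
    (hf : ∀ i j, ((alternatingWord i j (M i j)).map f).prod =
      ((alternatingWord j i (M i j)).map f).prod) {ω ω' : List B} (h : cs.IsReduced ω)
    (h' : cs.IsReduced ω') (e : cs.wordProd ω = cs.wordProd ω') :
    (ω.map f).prod = (ω'.map f).prod := by
  obtain ⟨n, hn⟩ : ∃ n, n = ω.length := ⟨_, rfl⟩
  induction n generalizing ω ω' with
  | zero =>
    have : ω'.length = 0 := by rw [← h'.eq, ← e, h.eq, hn]
    rw [List.eq_nil_of_length_eq_zero this, List.eq_nil_of_length_eq_zero hn.symm]
  | succ n ih =>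
    have hlen : ω'.length = n + 1 := by rw [← h'.eq, ← e, h.eq, hn]
    have same : ∀ (a : B) (σ σ' : List B), cs.IsReduced (a :: σ) → cs.IsReduced (a :: σ') →
        cs.wordProd (a :: σ) = cs.wordProd (a :: σ') → (a :: σ).length = n + 1 →
        ((a :: σ).map f).prod = ((a :: σ').map f).prod := by
      intro a σ σ' hσ hσ' he hl
      rw [List.map_cons, List.map_cons, List.prod_cons, List.prod_cons,
        ih (hσ.of_cons) (hσ'.of_cons) _ (by simpa using hl.symm)]
      simpa [wordProd_cons] using he
    match ω, ω', hn, hlen with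
    | i :: τ, j :: τ', hn, hlen =>
      rcases eq_or_ne i j with rfl | hij
      · exact same _ _ _ h h' e hn.symm
      have hi := h.isLeftDescent_cons
      have hj := h'.isLeftDescent_cons
      rw [← e] at hj
      -- Two words with different first letters are compared through two words that differ by one
      -- braid move; each outer comparison is between words with the same first letter.
      obtain ⟨ρ, r1, p1, r2, p2⟩ := cs.exists_isReduced_braid hij hi hj
      obtain ⟨m, hm⟩ := Nat.exists_eq_succ_of_ne_zero (cs.entry_ne_zero_of_isLeftDescent hij hi hj)
      have hb := prod_map_altFrom_comm hf i j
      rw [hm] at r1 p1 r2 p2 hb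
      have s1 := same i τ _ h r1 p1.symm hn.symm
      have s2 := same j τ' _ h' r2 (e.symm.trans p2.symm) hlen
      have : ∀ a b, (List.map f (a :: (altFrom b a m ++ ρ))).prod =
          (List.map f (altFrom a b (m + 1))).prod * (List.map f ρ).prod := by
        intro a b
        rw [← List.prod_append, ← List.map_append]; rfl
      exact s1.trans ((this i j).trans ((congrArg (· * _) hb).trans ((this j i).symm.trans s2.symm)))

end CoxeterSystem

/-! ### Rigid words and unique reduced expressions -/

namespace CoxeterMatrix

variable {B : Type*} (M : CoxeterMatrix B)

/-- A word is rigid if no nil move and no braid move can be applied to it. -/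
def IsRigid (ω : List B) : Prop :=
  (∀ i, ¬ [i, i] <:+: ω) ∧
    ∀ i j, i ≠ j → M i j ≠ 0 → ¬ CoxeterSystem.altFrom i j (M i j) <:+: ω

variable {M}

theorem IsRigid.of_infix {ω ω' : List B} (h : M.IsRigid ω) (h' : ω' <:+: ω) : M.IsRigid ω' :=
  ⟨fun i hi => h.1 i (hi.trans h'), fun i j hij h0 hi => h.2 i j hij h0 (hi.trans h')⟩

end CoxeterMatrix

namespace CoxeterSystem

variable {B W : Type*} [Group W] {M : CoxeterMatrix B} (cs : CoxeterSystem M W)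

/-- The element `w` has only one reduced expression. -/
def HasUniqueReduced (w : W) : Prop :=
  ∀ ω ω' : List B, cs.IsReduced ω → cs.IsReduced ω' → cs.wordProd ω = w → cs.wordProd ω' = w →
    ω = ω'

theorem exists_isReduced_cons {w : W} {i : B} (h : cs.IsLeftDescent w i) :
    ∃ ω, cs.IsReduced (i :: ω) ∧ cs.wordProd (i :: ω) = w := by
  obtain ⟨ω, hω, hω'⟩ := cs.exists_isReduced (cs.simple i * w)
  have hw : cs.wordProd (i :: ω) = w := by rw [wordProd_cons, ← hω']; simp
  refine ⟨ω, ?_, hw⟩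
  rw [IsReduced, hw, ← cs.isLeftDescent_iff.mp h, hω', hω.eq]
  rfl

theorem isReduced_cons_of_not_isLeftDescent {ω : List B} {i : B} (h : cs.IsReduced ω)
    (hi : ¬ cs.IsLeftDescent (cs.wordProd ω) i) : cs.IsReduced (i :: ω) := by
  rw [IsReduced, wordProd_cons, cs.not_isLeftDescent_iff.mp hi, h.eq]
  rfl

theorem HasUniqueReduced.inv {w : W} (h : cs.HasUniqueReduced w) : cs.HasUniqueReduced w⁻¹ := by
  intro ω ω' hω hω' e e'
  apply List.reverse_injective
  refine h _ _ hω.reverse hω'.reverse ?_ ?_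
  · rw [wordProd_reverse, e, inv_inv]
  · rw [wordProd_reverse, e', inv_inv]

theorem HasUniqueReduced.eq_of_isLeftDescent {w : W} (h : cs.HasUniqueReduced w) {i j : B}
    (hi : cs.IsLeftDescent w i) (hj : cs.IsLeftDescent w j) : i = j := by
  obtain ⟨ω, r, p⟩ := cs.exists_isReduced_cons hi
  obtain ⟨ω', r', p'⟩ := cs.exists_isReduced_cons hj
  exact (List.cons.inj (h _ _ r r' p p')).1

theorem hasUniqueReduced_one : cs.HasUniqueReduced (1 : W) := by
  intro ω ω' h h' e e'
  have h1 := h.eq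
  have h2 := h'.eq
  rw [e, length_one] at h1
  rw [e', length_one] at h2
  rw [List.eq_nil_of_length_eq_zero h1.symm, List.eq_nil_of_length_eq_zero h2.symm]

/-- If every left descent `r` of `w` satisfies `w = r y` for a fixed element `y` with a unique
reduced expression, then `w` has a unique reduced expression. -/
theorem HasUniqueReduced.of_forall_isLeftDescent {w y : W} (hy : cs.HasUniqueReduced y)
    (h : ∀ r, cs.IsLeftDescent w r → w = cs.simple r * y) : cs.HasUniqueReduced w := by
  rcases eq_or_ne w 1 with rfl | hw
  · exact cs.hasUniqueReduced_one
  intro ω ω' hω hω' e e'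
  match ω, ω' with
  | [], _ => exact absurd e.symm (by simpa using hw)
  | _ :: _, [] => exact absurd e'.symm (by simpa using hw)
  | i :: τ, j :: τ' =>
    have h1 := h i (e ▸ hω.isLeftDescent_cons)
    have h2 := h j (e' ▸ hω'.isLeftDescent_cons)
    have hij : i = j := cs.simple_injective (mul_right_cancel (h1.symm.trans h2))
    subst hij
    rw [wordProd_cons, h1, mul_right_inj] at e
    rw [wordProd_cons, h1, mul_right_inj] at e'
    rw [hy _ _ (hω.of_cons) (hω'.of_cons) e e']

/-- Both claims are proved together, since uniqueness for the tail is what exposes a forbidden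
factor: if `i τ` is not reduced, `τ` begins with `i`; if another reduced word begins with `j ≠ i`,
then `i τ` begins with a braid word. -/
theorem isReduced_and_unique_of_isRigid {ω : List B} (h : M.IsRigid ω) :
    cs.IsReduced ω ∧ ∀ ω', cs.IsReduced ω' → cs.wordProd ω' = cs.wordProd ω → ω' = ω := by
  induction ω with
  | nil =>
    refine ⟨by simp [IsReduced], fun ω' h' e => ?_⟩
    have := h'.eq
    rw [e, wordProd_nil, length_one] at this
    exact List.eq_nil_of_length_eq_zero this.symm
  | cons i τ ih =>
    obtain ⟨hr, hu⟩ := ih (h.of_infix (List.suffix_cons i τ).isInfix)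
    have hi : ¬ cs.IsLeftDescent (cs.wordProd τ) i := by
      intro hd
      obtain ⟨σ, r, p⟩ := cs.exists_isReduced_cons hd
      rw [← hu _ r p] at h
      exact h.1 i ⟨[], σ, rfl⟩
    have hred := cs.isReduced_cons_of_not_isLeftDescent hr hi
    have tail : ∀ σ, cs.IsReduced (i :: σ) → cs.wordProd (i :: σ) = cs.wordProd (i :: τ) →
        σ = τ := by
      intro σ r p
      refine hu σ (r.of_cons) ?_
      simpa [wordProd_cons] using p
    refine ⟨hred, fun ω' h' e => ?_⟩
    match ω' with
    | [] =>
      have := hred.eq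
      rw [← e] at this
      simp at this
    | j :: τ' =>
      rcases eq_or_ne j i with rfl | hij
      · rw [tail _ h' e]
      · exfalso
        have hj := h'.isLeftDescent_cons
        rw [e] at hj
        have h0 := cs.entry_ne_zero_of_isLeftDescent hij.symm (hred.isLeftDescent_cons) hj
        obtain ⟨ρ, r1, p1, -, -⟩ := cs.exists_isReduced_braid hij.symm (hred.isLeftDescent_cons) hj
        refine h.2 i j hij.symm h0 ⟨[], ρ, ?_⟩
        obtain ⟨m, hm⟩ := Nat.exists_eq_succ_of_ne_zero h0
        rw [hm] at r1 p1 ⊢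
        exact congrArg (i :: ·) (tail _ r1 p1)

theorem hasUniqueReduced_of_isRigid {ω : List B} (h : M.IsRigid ω) :
    cs.HasUniqueReduced (cs.wordProd ω) := by
  intro σ σ' r r' e e'
  obtain ⟨-, hu⟩ := cs.isReduced_and_unique_of_isRigid h
  rw [hu σ r e, hu σ' r' e']

theorem HasUniqueReduced.isRigid {ω : List B} (hω : cs.IsReduced ω)
    (h : cs.HasUniqueReduced (cs.wordProd ω)) : M.IsRigid ω := by
  constructor
  · rintro i ⟨a, b, rfl⟩
    have h1 : cs.wordProd (a ++ [i, i] ++ b) = cs.wordProd (a ++ b) := by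
      simp [wordProd_append, wordProd_cons]
    have h2 := hω.eq
    rw [h1] at h2
    have h3 := cs.length_wordProd_le (a ++ b)
    simp at h2 h3
    omega
  · rintro i j hij h0 ⟨a, b, rfl⟩
    have h1 : cs.wordProd (a ++ altFrom j i (M i j) ++ b) =
        cs.wordProd (a ++ altFrom i j (M i j) ++ b) := by
      simp only [wordProd_append, wordProd_altFrom_comm cs i j]
    have h2 : cs.IsReduced (a ++ altFrom j i (M i j) ++ b) := by
      rw [IsReduced, h1, hω.eq]; simp
    have h3 := h _ _ hω h2 rfl h1
    obtain ⟨m, hm⟩ := Nat.exists_eq_succ_of_ne_zero h0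
    rw [hm] at h3
    simp [altFrom] at h3
    exact hij h3.1

theorem finite_hasUniqueReduced_iff :
    {w : W | w ≠ 1 ∧ cs.HasUniqueReduced w}.Finite ↔ {ω : List B | M.IsRigid ω}.Finite := by
  constructor
  · intro h
    -- The element `1` is put back because the empty word is rigid.
    refine Set.Finite.of_finite_image (f := cs.wordProd) ((h.insert 1).subset ?_) ?_
    · rintro _ ⟨ω, hω, rfl⟩
      rcases eq_or_ne (cs.wordProd ω) 1 with h | h
      · exact Or.inl h
      · exact Or.inr ⟨h, cs.hasUniqueReduced_of_isRigid hω⟩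
    · intro ω hω ω' hω' e
      exact (cs.isReduced_and_unique_of_isRigid hω').2 _
        (cs.isReduced_and_unique_of_isRigid hω).1 e
  · intro h
    refine (h.image cs.wordProd).subset ?_
    rintro w ⟨-, hw⟩
    obtain ⟨ω, r, rfl⟩ := cs.exists_isReduced w
    exact ⟨ω, hw.isRigid cs r, rfl⟩

end CoxeterSystem

/-! ### Finiteness of the set of rigid words, read off the diagram -/

theorem SimpleGraph.IsAcyclic.injOn_of_forall_ne {V : Type*} {G : SimpleGraph V} (hG : G.IsAcyclic)
    {x : ℕ → V} {n : ℕ} (hadj : ∀ k < n, G.Adj (x k) (x (k + 1)))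
    (hne : ∀ k, k + 2 ≤ n → x k ≠ x (k + 2)) : Set.InjOn x {k | k ≤ n} := by
  have key : ∀ m ≤ n, ∃ p : G.Walk (x 0) (x m), p.support = (List.range (m + 1)).map x ∧
      p.edges = (List.range m).map fun k => s(x k, x (k + 1)) := by
    intro m hm
    induction m with
    | zero => exact ⟨.nil, by simp, by simp⟩
    | succ m ih =>
      obtain ⟨p, h1, h2⟩ := ih (by omega)
      refine ⟨p.concat (hadj m (by omega)), ?_, ?_⟩
      · rw [Walk.support_concat, h1, List.range_succ (n := m + 1)]; simp
      · rw [Walk.edges_concat, h2, List.range_succ]; simp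
  obtain ⟨p, h1, h2⟩ := key n le_rfl
  have hp : p.IsPath := by
    -- In a forest a walk is a path as soon as consecutive edges differ, that is, if it never turns
    -- back.
    rw [hG.isPath_iff_isChain, h2, List.isChain_map, List.isChain_range]
    intro m hm he
    rw [Sym2.eq_iff] at he
    rcases he with ⟨he, -⟩ | ⟨he, -⟩
    · exact (hadj m (by omega)).ne he
    · exact hne m (by omega) he
  have := hp.support_nodup
  rw [h1, List.nodup_map_iff_inj_on List.nodup_range] at this
  intro a ha b hb hab
  exact this a (by simpa [Nat.lt_succ_iff] using ha) b (by simpa [Nat.lt_succ_iff] using hb) hab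

namespace CoxeterMatrix

open CoxeterSystem

variable {B : Type*} {M : CoxeterMatrix B}

theorem mem_labeledEdges_iff {i j : B} (h : M.diagram.Adj i j) :
    s(i, j) ∈ M.labeledEdges ↔ M i j ≠ 3 := by
  have : s(i, j) ∈ M.diagram.edgeSet := h
  simp only [labeledEdges, Set.mem_ofPred_eq, this, true_and, label, Sym2.lift_mk]
  split_ifs with h0
  · simp [h0]
  · norm_cast

theorem label_ne_top_iff {i j : B} : M.label s(i, j) ≠ ⊤ ↔ M i j ≠ 0 := by
  simp only [label, Sym2.lift_mk]
  split_ifs with h0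
  · simp [h0]
  · simp [h0]

theorem IsIndecomposable.connected (h : M.IsIndecomposable) : M.diagram.Connected := by
  obtain ⟨⟨b⟩, h⟩ := h
  have : {i | M.diagram.Reachable b i} = Set.univ := by
    refine (h _ fun i hi j hj => ?_).resolve_left fun he => ?_
    · by_contra hM
      refine hj (SimpleGraph.Reachable.trans hi (SimpleGraph.Adj.reachable ⟨?_, hM⟩))
      rintro rfl
      exact hj hi
    · have : b ∈ {i | M.diagram.Reachable b i} := SimpleGraph.Reachable.refl b
      rw [he] at this
      exact this
  have hb : ∀ i, M.diagram.Reachable b i := fun i => Set.eq_univ_iff_forall.mp this i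
  exact (SimpleGraph.connected_iff _).mpr ⟨fun i j => (hb i).symm.trans (hb j), ⟨b⟩⟩

/-- All prefixes of such an endless walk are rigid: a braid word of finite length `m ≥ 3` turns
back, which forces `m ≥ 4`, and then it would have to turn back twice in succession. -/
theorem not_finite_isRigid {f : ℕ → B} (hadj : ∀ n, M.diagram.Adj (f n) (f (n + 1)))
    (hf : ∀ n, f n = f (n + 2) → M (f n) (f (n + 1)) = 0 ∨
      4 ≤ M (f n) (f (n + 1)) ∧ f (n + 1) ≠ f (n + 3)) :
    ¬ {ω : List B | M.IsRigid ω}.Finite := by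
  have hr : ∀ n, M.IsRigid ((List.range n).map f) := by
    intro n
    have get : ∀ (l : List B) (k : ℕ), l.length + k ≤ ((List.range n).map f).length →
        (∀ (i : ℕ) (h : i < l.length), ((List.range n).map f)[i + k]? = some l[i]) →
        ∀ (i : ℕ) (h : i < l.length), f (i + k) = l[i] := by
      intro l k hk h i hi
      have := h i hi
      rw [List.length_map, List.length_range] at hk
      rw [List.getElem?_map, List.getElem?_range (by omega)] at this
      simpa using this
    constructor
    · intro i hi
      obtain ⟨k, hk, hi⟩ := List.infix_iff_getElem?.mp hi
      have h0 := get _ k hk hi 0 (by simp)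
      have h1 := get _ k hk hi 1 (by simp)
      simp at h0 h1
      apply (hadj k).ne
      rw [h0, add_comm k 1, h1]
    · intro i j hij h0 hi
      obtain ⟨k, hk, hi⟩ := List.infix_iff_getElem?.mp hi
      have h1 := M.off_diagonal i j hij
      have hlen := length_altFrom i j (M i j)
      have e : ∀ p < M i j, f (p + k) = if Even p then i else j := by
        intro p hp
        rw [get _ k hk hi p (by omega), getElem_altFrom]
      have e0 := e 0 (by omega)
      have e1 := e 1 (by omega)
      rw [zero_add] at e0
      simp only [Even.zero, Nat.not_even_one, if_true, if_false] at e0 e1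
      have h2 := (hadj k).2
      rw [add_comm k 1, e0, e1] at h2
      have e2 := e 2 (by omega)
      simp only [even_two, if_true] at e2
      have hk' := hf k (by rw [add_comm k 2, e0, e2])
      rw [add_comm k 1, e0, e1] at hk'
      obtain ⟨h4, h5⟩ := hk'.resolve_left h0
      have e3 := e 3 (by omega)
      have : ¬ Even 3 := by decide
      simp only [this, if_false] at e3
      rw [add_comm k 3, e3] at h5
      exact h5 rfl
  intro hfin
  refine Set.infinite_range_of_injective (f := fun n => (List.range n).map f) ?_
    (hfin.subset (Set.range_subset_iff.mpr hr))
  intro a b hab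
  simpa using congrArg List.length hab

theorem not_finite_isRigid_of_entry_eq_zero {i j : B} (h : M i j = 0) :
    ¬ {ω : List B | M.IsRigid ω}.Finite := by
  have hij : i ≠ j := by rintro rfl; simp at h
  apply not_finite_isRigid (f := fun n => if Even n then i else j)
  · intro n
    by_cases hn : Even n
    · simpa [hn, Nat.even_add_one, diagram, h] using hij
    · simpa [hn, Nat.even_add_one, diagram, M.symmetric j i, h] using hij.symm
  · intro n _
    left
    by_cases hn : Even n
    · simp [hn, Nat.even_add_one, h]
    · simp [hn, Nat.even_add_one, h, M.symmetric j i]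

/-- Running around a cycle of length at least `3` never turns back. -/
theorem not_finite_isRigid_of_isCycle {u : B} {c : M.diagram.Walk u u} (hc : c.IsCycle) :
    ¬ {ω : List B | M.IsRigid ω}.Finite := by
  have h3 : 3 ≤ c.length := hc.three_le_length
  have hinj := hc.getVert_injOn'
  obtain ⟨L, hL⟩ : ∃ L, L = c.length := ⟨_, rfl⟩
  rw [← hL] at h3 hinj
  have hmod : ∀ n, n % L < L := fun n => Nat.mod_lt _ (by omega)
  have hsucc : ∀ n, (n + 1) % L = if n % L + 1 = L then 0 else n % L + 1 := by
    intro n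
    have := hmod n
    rw [Nat.add_mod, Nat.mod_eq_of_lt (show 1 < L by omega)]
    split_ifs with h
    · rw [h, Nat.mod_self]
    · exact Nat.mod_eq_of_lt (by omega)
  apply not_finite_isRigid (f := fun n => c.getVert (n % L))
  · intro n
    have h1 := c.adj_getVert_succ (i := n % L) (by rw [← hL]; exact hmod n)
    simp only [hsucc n]
    split_ifs with h
    · have hu : c.getVert L = u := by rw [hL, c.getVert_length]
      rw [h, hu] at h1
      rwa [c.getVert_zero]
    · exact h1
  · intro n h
    exfalso
    have h' := hinj (by have := hmod n; simp; omega) (by have := hmod (n + 2); simp; omega) h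
    have e1 := hsucc n
    have e2 := hsucc (n + 1)
    rw [show n + 1 + 1 = n + 2 from rfl] at e2
    have := hmod n
    split_ifs at e1 e2 <;> omega

/-- The walk runs to and fro along the path. It turns back only at the two ends, where the label is
at least `4`, and `2 ≤ p.length` keeps two turns from being consecutive. -/
theorem not_finite_isRigid_of_isPath {x y : B} {p : M.diagram.Walk x y} (hp : p.IsPath)
    (hL : 2 ≤ p.length) (h4 : 4 ≤ M x (p.getVert 1))
    (h4' : 4 ≤ M y (p.getVert (p.length - 1))) :
    ¬ {ω : List B | M.IsRigid ω}.Finite := by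
  have hinj := hp.getVert_injOn
  obtain ⟨L, hL'⟩ : ∃ L, L = p.length := ⟨_, rfl⟩
  have hx : p.getVert 0 = x := p.getVert_zero
  have hy : p.getVert L = y := by rw [hL', p.getVert_length]
  have hadj := fun i (hi : i < p.length) => p.adj_getVert_succ hi
  rw [← hL'] at hL hinj h4' hadj
  have hmod : ∀ n, n % (2 * L) < 2 * L := fun n => Nat.mod_lt _ (by omega)
  have hsucc : ∀ n, (n + 1) % (2 * L) = if n % (2 * L) + 1 = 2 * L then 0
      else n % (2 * L) + 1 := by
    intro n
    have := hmod n
    rw [Nat.add_mod, Nat.mod_eq_of_lt (show 1 < 2 * L by omega)]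
    split_ifs with h
    · rw [h, Nat.mod_self]
    · exact Nat.mod_eq_of_lt (by omega)
  -- The triangle wave of period `2 * L`, giving the position on the path at time `n`.
  obtain ⟨z, hz⟩ : ∃ z : ℕ → ℕ, ∀ n, z n = if n % (2 * L) ≤ L then n % (2 * L)
      else 2 * L - n % (2 * L) := ⟨_, fun _ => rfl⟩
  have z1 : ∀ n, z n ≤ L := by intro n; rw [hz]; split_ifs <;> omega
  have z2 : ∀ n, z (n + 1) = z n + 1 ∨ z n = z (n + 1) + 1 := by
    intro n
    have e1 := hsucc n
    have := hmod n
    rw [hz, hz]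
    split_ifs at * <;> omega
  have z3 : ∀ n, z n = z (n + 2) → (z (n + 1) = 0 ∧ z n = 1) ∨ (z (n + 1) = L ∧ z n = L - 1) := by
    intro n h
    have e1 := hsucc n
    have e2 := hsucc (n + 1)
    rw [show n + 1 + 1 = n + 2 from rfl] at e2
    have := hmod n
    rw [hz, hz] at *
    split_ifs at * <;> omega
  have zinj : ∀ a b, p.getVert (z a) = p.getVert (z b) → z a = z b :=
    fun a b h => hinj (z1 a) (z1 b) h
  apply not_finite_isRigid (f := fun n => p.getVert (z n))
  · intro n
    have ha := z1 n
    have hb := z1 (n + 1)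
    rcases z2 n with h | h
    · simp only [h]; exact hadj _ (by omega)
    · simp only [h]; exact (hadj _ (by omega)).symm
  · intro n h
    right
    have hn := z3 n (zinj _ _ h)
    refine ⟨?_, fun h' => ?_⟩
    · rcases hn with ⟨e1, e2⟩ | ⟨e1, e2⟩
      · simp only [e1, e2, hx]; rwa [M.symmetric]
      · simp only [e1, e2, hy]; rwa [M.symmetric]
    · have hn' := z3 (n + 1) (zinj _ _ h')
      have := zinj _ _ h
      rw [show n + 1 + 1 = n + 2 from rfl] at hn'
      omega

/-- Two labeled edges, oriented so that their inner ends `x`, `y` are as close as possible, extend a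
shortest path from `x` to `y` to a path with both edges at its ends. Minimality keeps the outer
vertices off the shortest path. -/
theorem labeledEdges_subsingleton_of_finite (hM : M.diagram.Connected)
    (h0 : ∀ i j, M i j ≠ 0) (hfin : {ω : List B | M.IsRigid ω}.Finite) :
    M.labeledEdges.Subsingleton := by
  classical
  intro e he e' he'
  by_contra hne
  have hex : ∃ n x x' y y', s(x', x) = e ∧ s(y, y') = e' ∧ M.diagram.dist x y = n := by
    induction e with | _ a b
    induction e' with | _ c d
    exact ⟨_, b, a, c, d, rfl, rfl, rfl⟩
  obtain ⟨x, x', y, y', hx, hy, hd⟩ := Nat.find_spec hex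
  have hmin : ∀ a a' b b', s(a', a) = e → s(b, b') = e' →
      M.diagram.dist x y ≤ M.diagram.dist a b := by
    intro a a' b b' h1 h2
    rw [hd]
    exact Nat.find_min' hex ⟨a, a', b, b', h1, h2, rfl⟩
  obtain ⟨p, hp, hpd⟩ := hM.exists_path_of_dist x y
  subst hx hy
  have ax : M.diagram.Adj x' x := he.1
  have ay : M.diagram.Adj y y' := he'.1
  have four : ∀ {i j}, M.diagram.Adj i j → s(i, j) ∈ M.labeledEdges → 4 ≤ M i j := by
    intro i j ha hl
    have h1 := M.off_diagonal i j ha.1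
    have h2 := ha.2
    have h3 := (mem_labeledEdges_iff ha).mp hl
    have := h0 i j
    omega
  have hx' : x' ∉ p.support := by
    intro hmem
    have h1 := hmin x' x y y' Sym2.eq_swap rfl
    have h2 := SimpleGraph.dist_le (p.dropUntil x' hmem)
    have h3 := congrArg SimpleGraph.Walk.length (p.take_spec hmem)
    rw [SimpleGraph.Walk.length_append] at h3
    have h4 : (p.takeUntil x' hmem).length = 0 := by omega
    exact ax.ne (SimpleGraph.Walk.eq_of_length_eq_zero h4).symm
  have hy' : y' ∉ p.support := by
    intro hmem
    have h1 := hmin x x' y' y rfl Sym2.eq_swap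
    have h2 := SimpleGraph.dist_le (p.takeUntil y' hmem)
    have h3 := congrArg SimpleGraph.Walk.length (p.take_spec hmem)
    rw [SimpleGraph.Walk.length_append] at h3
    have h4 : (p.dropUntil y' hmem).length = 0 := by omega
    exact ay.ne (SimpleGraph.Walk.eq_of_length_eq_zero h4).symm
  have hxy' : x' ≠ y' := by
    rintro rfl
    have h1 := hmin x' x x' y Sym2.eq_swap Sym2.eq_swap
    rw [SimpleGraph.dist_self, ← hpd] at h1
    have := SimpleGraph.Walk.eq_of_length_eq_zero (Nat.le_zero.mp h1)
    subst this
    exact hne Sym2.eq_swap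
  have hq : (SimpleGraph.Walk.cons ax (p.concat ay)).IsPath := by
    rw [SimpleGraph.Walk.cons_isPath_iff, SimpleGraph.Walk.support_concat]
    refine ⟨hp.concat hy' ay, ?_⟩
    simp [hx', hxy']
  refine not_finite_isRigid_of_isPath hq (by simp) ?_ ?_ hfin
  · simpa using four ax he
  · have : (SimpleGraph.Walk.cons ax (p.concat ay)).penultimate = y := by
      rw [SimpleGraph.Walk.penultimate_cons_of_not_nil, SimpleGraph.Walk.penultimate_concat]
      simp [SimpleGraph.Walk.concat_eq_append]
    rw [← SimpleGraph.Walk.penultimate.eq_1, this, M.symmetric]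
    exact four ay he'

/-- The labeled edge is traversed within about `Nat.card B` steps of either end of the word, and at
every step in between. That middle section alternates, so it is shorter than the label, at most `K`.
The constant is not sharp. -/
theorem IsRigid.length_le [Finite B] (hac : M.diagram.IsAcyclic)
    (hsub : M.labeledEdges.Subsingleton) (h0 : ∀ i j, M.diagram.Adj i j → M i j ≠ 0) {K : ℕ}
    (hK : ∀ i j, M i j ≤ K) {ω : List B} (hω : M.IsRigid ω) :
    ω.length ≤ 2 * Nat.card B + K + 5 := by
  by_contra! hlt
  obtain ⟨b₀⟩ : Nonempty B := ⟨ω[0]⟩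
  obtain ⟨x, hx⟩ : ∃ x : ℕ → B, ∀ k, x k = ω.getD k b₀ := ⟨_, fun _ => rfl⟩
  obtain ⟨N, hN⟩ : ∃ N, N = ω.length := ⟨_, rfl⟩
  have hx' : ∀ k < N, ω[k]? = some (x k) := by
    intro k hk
    rw [hx, List.getD_eq_getElem _ _ (by omega), List.getElem?_eq_getElem (by omega)]
  have hinf : ∀ (l : List B) (k : ℕ), l.length + k ≤ N →
      (∀ (p : ℕ) (h : p < l.length), x (p + k) = l[p]) → l <:+: ω := by
    intro l k hk h
    refine List.infix_iff_getElem?.mpr ⟨k, by omega, fun p hp => ?_⟩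
    rw [hx' _ (by omega), h p hp]
  have hadj : ∀ k, k + 1 < N → M.diagram.Adj (x k) (x (k + 1)) := by
    intro k hk
    have hne : x k ≠ x (k + 1) := by
      intro h
      refine hω.1 (x k) (hinf _ k (by simp; omega) fun p hp => ?_)
      match p, hp with
      | 0, _ => simp
      | 1, _ => simp [h, add_comm]
    refine ⟨hne, fun h2 => ?_⟩
    refine hω.2 _ _ hne (by omega) (hinf _ k (by simp; omega) fun p hp => ?_)
    rw [getElem_altFrom]
    rw [length_altFrom, h2] at hp
    match p, hp with
    | 0, _ => simp
    | 1, _ => simp [add_comm]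
  have hback : ∀ k, k + 2 < N → x k = x (k + 2) → s(x k, x (k + 1)) ∈ M.labeledEdges := by
    intro k hk h
    have ha := hadj k (by omega)
    rw [mem_labeledEdges_iff ha]
    intro h3
    refine hω.2 _ _ ha.1 (by omega) (hinf _ k (by simp; omega) fun p hp => ?_)
    rw [getElem_altFrom]
    rw [length_altFrom, h3] at hp
    match p, hp with
    | 0, _ => simp
    | 1, _ => simp [add_comm]
    | 2, _ => simp [h, add_comm]
  obtain ⟨E, hE⟩ : ∃ E : ℕ → Prop, ∀ k, E k ↔ k + 1 < N ∧ s(x k, x (k + 1)) ∈ M.labeledEdges :=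
    ⟨_, fun _ => Iff.rfl⟩
  have hback' : ∀ k, k + 2 < N → x k = x (k + 2) → E k ∧ E (k + 1) := by
    intro k hk h
    refine ⟨(hE k).mpr ⟨by omega, hback k hk h⟩, (hE _).mpr ⟨by omega, ?_⟩⟩
    rw [show k + 1 + 1 = k + 2 from rfl, ← h, Sym2.eq_swap]
    exact hback k hk h
  have hinj : ∀ a n, a + n < N → (∀ k, k + 2 ≤ n → x (a + k) ≠ x (a + (k + 2))) →
      Set.InjOn (fun k => x (a + k)) {k | k ≤ n} := by
    intro a n han h
    exact hac.injOn_of_forall_ne (fun k hk => hadj (a + k) (by omega)) h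
  -- Turning back uses the labeled edge; without it, `Nat.card B + 1` consecutive vertices would be
  -- distinct.
  have hseg : ∀ a, a + Nat.card B < N → ∃ k, a ≤ k ∧ k + 2 ≤ a + Nat.card B ∧ E k := by
    intro a ha
    by_contra! hno
    have hi := hinj a (Nat.card B) ha fun k hk h =>
      hno (a + k) (by omega) (by omega) (hback' (a + k) (by omega) h).1
    have h1 : Set.ncard {k | k ≤ Nat.card B} ≤ Nat.card B := by
      rw [← hi.ncard_image, ← Set.ncard_univ]
      exact Set.ncard_le_ncard (Set.subset_univ _)
    have h2 : {k | k ≤ Nat.card B} = ((Finset.range (Nat.card B + 1) : Finset ℕ) : Set ℕ) := by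
      ext; simp
    rw [h2, Set.ncard_coe_finset, Finset.card_range] at h1
    omega
  -- Once left, the labeled edge cannot be reached again: the excursion would be a path in a tree
  -- whose first and last edges coincide.
  have hcont : ∀ d k, E k → E (k + d) → ∀ p ≤ d, E (k + p) := by
    intro d
    induction d using Nat.strong_induction_on with
    | _ d ih =>
      intro k hk hkd p hp
      rcases Nat.lt_or_ge d 2 with hd | hd
      · rcases (show p = 0 ∨ p = d by omega) with rfl | rfl
        · exact hk
        · exact hkd
      obtain ⟨q, hq0, hqd, hq⟩ : ∃ q, 0 < q ∧ q < d ∧ E (k + q) := by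
        by_contra! hno
        have hkd' := (hE _).mp hkd
        have hk' := (hE _).mp hk
        have hi := hinj k (d + 1) (by omega) fun r hr h => by
          have h' := hback' (k + r) (by omega) h
          rcases Nat.eq_zero_or_pos r with rfl | hr0
          · exact hno 1 (by omega) (by omega) h'.2
          · exact hno r hr0 (by omega) h'.1
        have he := hsub hk'.2 hkd'.2
        rw [Sym2.eq_iff] at he
        rcases he with ⟨he, -⟩ | ⟨he, -⟩
        · have := hi (show 0 ≤ d + 1 by omega) (show d ≤ d + 1 by omega) he
          omega
        · have := hi (show 0 ≤ d + 1 by omega) (show d + 1 ≤ d + 1 by omega) he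
          omega
      rcases le_total p q with hpq | hpq
      · exact ih q hqd k hk hq p hpq
      · have := ih (d - q) (by omega) (k + q) hq (by rwa [show k + q + (d - q) = k + d by omega])
          (p - q) (by omega)
        rwa [show k + q + (p - q) = k + p by omega] at this
  obtain ⟨k₁, -, hk₁, hE₁⟩ := hseg 0 (by omega)
  obtain ⟨k₂, hk₂, -, hE₂⟩ := hseg (N - 1 - Nat.card B) (by omega)
  have hall := hcont (k₂ - k₁) k₁ hE₁ (by rwa [show k₁ + (k₂ - k₁) = k₂ by omega])
  have hE₁' := (hE _).mp hE₁
  have ha := hadj k₁ hE₁'.1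
  have halt : ∀ p, p ≤ k₂ - k₁ → x (p + k₁) = if Even p then x k₁ else x (k₁ + 1) := by
    intro p hp
    induction p with
    | zero => simp
    | succ p ihp =>
      have h1 := ihp (by omega)
      have h2 := hsub hE₁'.2 ((hE _).mp (hall p (by omega))).2
      rw [Sym2.eq_iff, add_comm k₁ p, h1, add_right_comm p k₁ 1] at h2
      by_cases hpe : Even p
      · simp only [hpe, if_true, Nat.even_add_one, not_true, if_false] at h2 ⊢
        rcases h2 with h2 | h2
        · exact h2.2.symm
        · exact absurd h2.2.symm ha.1
      · simp only [hpe, if_false, Nat.even_add_one, not_false_iff, if_true] at h2 ⊢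
        rcases h2 with h2 | h2
        · exact absurd h2.1 ha.1
        · exact h2.1.symm
  have hKb := hK (x k₁) (x (k₁ + 1))
  refine hω.2 _ _ ha.1 (h0 _ _ ha) (hinf _ k₁ (by rw [length_altFrom]; omega) fun p hp => ?_)
  rw [getElem_altFrom]
  rw [length_altFrom] at hp
  exact halt p (by omega)

theorem finite_isRigid_iff [Finite B] (hM : M.IsIndecomposable) :
    {ω : List B | M.IsRigid ω}.Finite ↔
      M.diagram.IsTree ∧ M.labeledEdges.Subsingleton ∧
        ∀ e ∈ M.diagram.edgeSet, M.label e ≠ ⊤ := by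
  constructor
  · intro hfin
    have h0 : ∀ i j, M i j ≠ 0 := fun i j h => not_finite_isRigid_of_entry_eq_zero h hfin
    refine ⟨⟨hM.connected, fun u c hc => not_finite_isRigid_of_isCycle hc hfin⟩,
      labeledEdges_subsingleton_of_finite hM.connected h0 hfin, fun e he => ?_⟩
    induction e with | _ i j
    exact label_ne_top_iff.mpr (h0 i j)
  · rintro ⟨htree, hsub, hlab⟩
    obtain ⟨K, hK⟩ := (Set.finite_range fun p : B × B => M p.1 p.2).bddAbove
    refine (List.finite_length_le B (2 * Nat.card B + K + 5)).subset fun ω hω => ?_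
    exact IsRigid.length_le htree.isAcyclic hsub
      (fun i j h => label_ne_top_iff.mp (hlab s(i, j) h)) (fun i j => hK ⟨(i, j), rfl⟩) hω

end CoxeterMatrix

namespace CoxeterMatrix

variable {B : Type*} {M : CoxeterMatrix B}

theorem hecke_induction {p : M.Hecke → Prop} (h : M.Hecke)
    (scalar : ∀ r : ℤ[T;T⁻¹], p (algebraMap _ _ r)) (gen : ∀ i, p (M.heckeGen i))
    (mul : ∀ a b, p a → p b → p (a * b)) (add : ∀ a b, p a → p b → p (a + b)) : p h := by
  obtain ⟨x, rfl⟩ : ∃ x, M.heckeMk x = h := RingQuot.mkAlgHom_surjective _ _ h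
  induction x using FreeAlgebra.induction with
  | grade0 r => rw [AlgHom.commutes]; exact scalar r
  | grade1 i => exact gen i
  | mul a b ha hb => rw [map_mul]; exact mul _ _ ha hb
  | add a b ha hb => rw [map_add]; exact add _ _ ha hb

end CoxeterMatrix

namespace CoxeterSystem

open LaurentPolynomial (T)

variable {B W : Type*} [Group W] {M : CoxeterMatrix B} (cs : CoxeterSystem M W)

/-! ### The standard basis of the Hecke algebra -/

theorem heckeStd_wordProd {ω : List B} (h : cs.IsReduced ω) :
    cs.heckeStd (cs.wordProd ω) = (ω.map M.heckeGen).prod := by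
  have hc := (cs.exists_isReduced (cs.wordProd ω)).choose_spec
  exact cs.prod_map_eq_of_isReduced M.heckeGen_braid hc.1 h hc.2.symm

theorem heckeStd_one : cs.heckeStd 1 = 1 := by
  have : cs.IsReduced [] := by simp [IsReduced]
  simpa using cs.heckeStd_wordProd this

theorem heckeGen_mul_heckeStd_of_not {w : W} {i : B} (h : ¬ cs.IsLeftDescent w i) :
    M.heckeGen i * cs.heckeStd w = cs.heckeStd (cs.simple i * w) := by
  obtain ⟨ω, r, rfl⟩ := cs.exists_isReduced w
  rw [← wordProd_cons, heckeStd_wordProd cs r,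
    heckeStd_wordProd cs (cs.isReduced_cons_of_not_isLeftDescent r h)]
  simp

theorem heckeGen_mul_heckeStd_of_isLeftDescent {w : W} {i : B} (h : cs.IsLeftDescent w i) :
    M.heckeGen i * cs.heckeStd w =
      cs.heckeStd (cs.simple i * w) + (T (-1) - T 1 : ℤ[T;T⁻¹]) • cs.heckeStd w := by
  have h' : ¬ cs.IsLeftDescent (cs.simple i * w) i :=
    cs.isLeftDescent_iff_not_isLeftDescent_mul.mp h
  have e := cs.heckeGen_mul_heckeStd_of_not h'
  rw [simple_mul_simple_cancel_left] at e
  rw [← e, ← mul_assoc, CoxeterMatrix.heckeGen_mul_self, add_mul, one_mul, smul_mul_assoc]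

theorem isReduced_altFrom {i j : B} (hij : i ≠ j) {k : ℕ} (hk : k ≤ M i j) :
    cs.IsReduced (altFrom i j k) := by
  induction k generalizing i j with
  | zero => simp [altFrom, IsReduced]
  | succ k ih =>
    refine cs.isReduced_cons_of_not_isLeftDescent
      (ih hij.symm (by rw [M.symmetric]; omega)) fun hd => ?_
    obtain ⟨p, hp, hp'⟩ := cs.exists_eraseIdx_of_isLeftDescent hd
    rw [← wordProd_cons] at hp'
    refine cs.wordProd_altFrom_ne hij (k := k) (by omega) (fun b hb => ?_) ?_ hp'
    · exact (mem_altFrom (List.mem_of_mem_eraseIdx hb)).symm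
    · rw [List.length_eraseIdx_of_lt hp]
      rw [length_altFrom] at hp ⊢
      omega

/-- The exchange in a reduced word of `w` followed by `j` must delete the final `j`; deleting an
earlier letter would make `s_i w` shorter than `w`. -/
theorem simple_mul_eq_mul_simple {w : W} {i j : B} (h : ¬ cs.IsLeftDescent w i)
    (h' : cs.IsLeftDescent (w * cs.simple j) i) : cs.simple i * w = w * cs.simple j := by
  have h1 := cs.not_isLeftDescent_iff.mp h
  have h2 := cs.isLeftDescent_iff.mp h'
  have h3 := cs.length_mul_simple (cs.simple i * w) j
  have h4 := cs.length_mul_simple w j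
  rw [mul_assoc] at h3
  obtain ⟨ω, r, hω⟩ := cs.exists_isReduced w
  have hj : cs.wordProd (ω ++ [j]) = w * cs.simple j := by rw [wordProd_append, ← hω]; simp
  rw [← hj] at h'
  obtain ⟨p, hp, hp'⟩ := cs.exists_eraseIdx_of_isLeftDescent h'
  rw [hj] at hp'
  have hlen : cs.length w = ω.length := by rw [hω, r.eq]
  rcases Nat.lt_or_ge p ω.length with hpω | hpω
  · exfalso
    rw [List.eraseIdx_append_of_lt_length hpω, wordProd_append, wordProd_singleton, ← mul_assoc,
      mul_left_inj] at hp'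
    have := cs.length_wordProd_le (ω.eraseIdx p)
    rw [← hp', List.length_eraseIdx_of_lt hpω] at this
    omega
  · have hpe : p = ω.length := by simp at hp; omega
    rw [List.eraseIdx_append_of_length_le hpω, hpe] at hp'
    simp at hp'
    rw [← hω] at hp'
    rw [← cs.simple_mul_simple_cancel_left (w := w * cs.simple j) i, hp']

section RegularRepresentation

open Classical in
/-- Left multiplication by `H_i` in the regular representation. -/
def leftOp (i : B) : Module.End ℤ[T;T⁻¹] (W →₀ ℤ[T;T⁻¹]) :=
  Finsupp.linearCombination ℤ[T;T⁻¹] fun w => Finsupp.single (cs.simple i * w) 1 +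
    if cs.IsLeftDescent w i then (T (-1) - T 1 : ℤ[T;T⁻¹]) • Finsupp.single w 1 else 0

open Classical in
/-- Right multiplication by `H_i` in the regular representation. -/
def rightOp (i : B) : Module.End ℤ[T;T⁻¹] (W →₀ ℤ[T;T⁻¹]) :=
  Finsupp.linearCombination ℤ[T;T⁻¹] fun w => Finsupp.single (w * cs.simple i) 1 +
    if cs.IsRightDescent w i then (T (-1) - T 1 : ℤ[T;T⁻¹]) • Finsupp.single w 1 else 0

open Classical in
theorem leftOp_single (i : B) (w : W) : cs.leftOp i (Finsupp.single w 1) =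
    Finsupp.single (cs.simple i * w) 1 +
      if cs.IsLeftDescent w i then (T (-1) - T 1 : ℤ[T;T⁻¹]) • Finsupp.single w 1 else 0 := by
  simp only [leftOp, Finsupp.linearCombination_single, one_smul]

open Classical in
theorem rightOp_single (i : B) (w : W) : cs.rightOp i (Finsupp.single w 1) =
    Finsupp.single (w * cs.simple i) 1 +
      if cs.IsRightDescent w i then (T (-1) - T 1 : ℤ[T;T⁻¹]) • Finsupp.single w 1 else 0 := by
  simp only [rightOp, Finsupp.linearCombination_single, one_smul]

theorem leftOp_comm_rightOp (i j : B) : Commute (cs.leftOp i) (cs.rightOp j) := by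
  classical
  refine Finsupp.lhom_ext' fun w => LinearMap.ext_ring ?_
  simp only [LinearMap.comp_apply, Finsupp.lsingle_apply, Module.End.mul_apply]
  have a1 := cs.length_simple_mul w i
  have a2 := cs.length_simple_mul (w * cs.simple j) i
  have a3 := cs.length_mul_simple w j
  have a4 := cs.length_mul_simple (cs.simple i * w) j
  rw [mul_assoc] at a4
  -- Either both multiplications move `w` to the same element, or neither affects the descent used
  -- by the other.
  have key : cs.simple i * w = w * cs.simple j ∨
      ((cs.IsLeftDescent w i ↔ cs.IsLeftDescent (w * cs.simple j) i) ∧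
        (cs.IsRightDescent w j ↔ cs.IsRightDescent (cs.simple i * w) j)) := by
    by_cases h : cs.simple i * w = w * cs.simple j
    · exact Or.inl h
    · have h1 : cs.IsLeftDescent w i ↔ cs.IsLeftDescent (w * cs.simple j) i := by
        by_contra hne
        by_cases hd : cs.IsLeftDescent w i
        · have hd' : ¬ cs.IsLeftDescent (w * cs.simple j) i := by tauto
          have := cs.simple_mul_eq_mul_simple (w := w * cs.simple j) (i := i) (j := j) hd'
            (by rwa [simple_mul_simple_cancel_right])
          rw [simple_mul_simple_cancel_right] at this
          apply h
          nth_rw 1 [← this]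
          simp
        · exact h (cs.simple_mul_eq_mul_simple hd (by tauto))
      refine Or.inr ⟨h1, ?_⟩
      rw [IsLeftDescent, IsLeftDescent] at h1
      rw [IsRightDescent, IsRightDescent, mul_assoc]
      omega
  rw [leftOp_single, rightOp_single, map_add, map_add, leftOp_single, rightOp_single]
  rcases key with h | ⟨h1, h2⟩
  · have hc : cs.simple i * (w * cs.simple j) = w := by rw [← h]; simp
    have hc' : cs.simple i * w * cs.simple j = w := by rw [h]; simp
    have d1 : cs.IsLeftDescent (w * cs.simple j) i ↔ ¬ cs.IsRightDescent w j := by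
      rw [IsLeftDescent, IsRightDescent, hc]; omega
    have d2 : cs.IsRightDescent (cs.simple i * w) j ↔ ¬ cs.IsLeftDescent w i := by
      rw [IsLeftDescent, IsRightDescent, hc']; rw [hc] at a4; omega
    have d3 : cs.IsRightDescent w j ↔ cs.IsLeftDescent w i := by
      rw [IsLeftDescent, IsRightDescent, h]
    rw [hc, hc']
    simp only [d1, d2, d3]
    by_cases hd : cs.IsLeftDescent w i
    · simp only [hd, if_true, not_true, if_false, map_smul, leftOp_single, rightOp_single, d3, h]
    · simp [hd, h]
  · simp only [← h1, ← h2, mul_assoc]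
    by_cases hd : cs.IsLeftDescent w i <;> by_cases hd' : cs.IsRightDescent w j <;>
      simp only [hd, hd', if_true, if_false, map_smul, map_zero, add_zero, leftOp_single,
        rightOp_single]
    all_goals module

theorem prod_map_leftOp_apply {ω : List B} (h : cs.IsReduced ω) :
    (ω.map cs.leftOp).prod (Finsupp.single 1 1) = Finsupp.single (cs.wordProd ω) 1 := by
  induction ω with
  | nil => simp
  | cons i ω ih =>
    have hd : ¬ cs.IsLeftDescent (cs.wordProd ω) i := by
      have := h.isLeftDescent_cons
      rw [cs.isLeftDescent_iff_not_isLeftDescent_mul, wordProd_cons,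
        simple_mul_simple_cancel_left] at this
      exact this
    rw [List.map_cons, List.prod_cons, Module.End.mul_apply, ih h.of_cons, leftOp_single,
      if_neg hd, wordProd_cons, add_zero]

/-- Right operators generate the module from the basis vector at `1`. This reduces the braid
relations for `leftOp` to a check on one vector. -/
theorem eq_of_commute_rightOp {X Y : Module.End ℤ[T;T⁻¹] (W →₀ ℤ[T;T⁻¹])}
    (hX : ∀ j, Commute X (cs.rightOp j)) (hY : ∀ j, Commute Y (cs.rightOp j))
    (h : X (Finsupp.single 1 1) = Y (Finsupp.single 1 1)) : X = Y := by
  refine Finsupp.lhom_ext' fun w => LinearMap.ext_ring ?_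
  simp only [LinearMap.comp_apply, Finsupp.lsingle_apply]
  obtain ⟨n, hn⟩ : ∃ n, n = cs.length w := ⟨_, rfl⟩
  induction n generalizing w with
  | zero =>
    rw [cs.length_eq_zero_iff.mp hn.symm]
    exact h
  | succ n ih =>
    have hw : w ≠ 1 := by rintro rfl; simp at hn
    obtain ⟨j, hj⟩ := cs.exists_rightDescent_of_ne_one hw
    have hl := cs.isRightDescent_iff.mp hj
    have hj' : ¬ cs.IsRightDescent (w * cs.simple j) j :=
      cs.isRightDescent_iff_not_isRightDescent_mul.mp hj
    have e : Finsupp.single w 1 = cs.rightOp j (Finsupp.single (w * cs.simple j) 1) := by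
      rw [rightOp_single, if_neg hj', simple_mul_simple_cancel_right, add_zero]
    rw [e, ← Module.End.mul_apply, ← Module.End.mul_apply, (hX j).eq, (hY j).eq,
      Module.End.mul_apply, Module.End.mul_apply, ih _ (by omega)]

theorem leftOp_rel ⦃x y : FreeAlgebra ℤ[T;T⁻¹] B⦄ (h : M.HeckeRel x y) :
    FreeAlgebra.lift ℤ[T;T⁻¹] cs.leftOp x = FreeAlgebra.lift ℤ[T;T⁻¹] cs.leftOp y := by
  cases h with
  | quadratic i =>
    simp only [map_mul, map_add, map_one, map_smul, FreeAlgebra.lift_ι_apply]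
    refine Finsupp.lhom_ext' fun w => LinearMap.ext_ring ?_
    simp only [LinearMap.comp_apply, Finsupp.lsingle_apply, Module.End.mul_apply,
      LinearMap.add_apply, LinearMap.smul_apply, Module.End.one_apply]
    have hd := cs.isLeftDescent_iff_not_isLeftDescent_mul (w := w) (i := i)
    by_cases h : cs.IsLeftDescent w i
    · simp only [leftOp_single, h, if_true, map_add, map_smul, hd.mp h, if_false,
        simple_mul_simple_cancel_left]
      module
    · have h' : cs.IsLeftDescent (cs.simple i * w) i := by tauto
      simp only [leftOp_single, h, if_false, map_add, map_zero, h', if_true,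
        simple_mul_simple_cancel_left]
      module
  | braid i j =>
    rcases eq_or_ne i j with rfl | hij
    · rfl
    simp only [map_list_prod, List.map_map]
    have e : (FreeAlgebra.lift ℤ[T;T⁻¹] cs.leftOp ∘ FreeAlgebra.ι ℤ[T;T⁻¹]) = cs.leftOp :=
      funext fun i => FreeAlgebra.lift_ι_apply cs.leftOp i
    rw [e]
    have comm : ∀ (ω : List B) (b : B), Commute (ω.map cs.leftOp).prod (cs.rightOp b) := by
      intro ω b
      refine Commute.list_prod_left _ _ fun x hx => ?_
      obtain ⟨a, -, rfl⟩ := List.mem_map.mp hx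
      exact cs.leftOp_comm_rightOp a b
    have red : ∀ a b, a ≠ b → cs.IsReduced (alternatingWord a b (M a b)) := by
      intro a b hab
      have := cs.isReduced_altFrom hab.symm (k := M a b) (by rw [M.symmetric])
      rw [altFrom_eq_reverse, isReduced_reverse_iff] at this
      exact this
    refine cs.eq_of_commute_rightOp (comm _) (comm _) ?_
    have r2 := red j i hij.symm
    have hb := cs.wordProd_braidWord_eq i j
    rw [braidWord, braidWord] at hb
    rw [M.symmetric j i] at r2 hb
    rw [prod_map_leftOp_apply cs (red i j hij), prod_map_leftOp_apply cs r2, hb]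

/-- The regular representation of the Hecke algebra on the free module with basis `W`. -/
def regularRep : M.Hecke →ₐ[ℤ[T;T⁻¹]] Module.End ℤ[T;T⁻¹] (W →₀ ℤ[T;T⁻¹]) :=
  RingQuot.liftAlgHom _ ⟨FreeAlgebra.lift ℤ[T;T⁻¹] cs.leftOp, cs.leftOp_rel⟩

theorem regularRep_heckeGen (i : B) : cs.regularRep (M.heckeGen i) = cs.leftOp i := by
  have := RingQuot.liftAlgHom_mkAlgHom_apply ℤ[T;T⁻¹] (FreeAlgebra.lift ℤ[T;T⁻¹] cs.leftOp)
    cs.leftOp_rel (FreeAlgebra.ι _ i)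
  rw [FreeAlgebra.lift_ι_apply] at this
  exact this

theorem regularRep_heckeStd (w : W) :
    cs.regularRep (cs.heckeStd w) (Finsupp.single 1 1) = Finsupp.single w 1 := by
  obtain ⟨ω, r, rfl⟩ := cs.exists_isReduced w
  rw [heckeStd_wordProd cs r, map_list_prod, List.map_map]
  have : cs.regularRep ∘ M.heckeGen = cs.leftOp := funext cs.regularRep_heckeGen
  rw [this, prod_map_leftOp_apply cs r]

end RegularRepresentation

/-- Acting on the basis vector at `1` in the regular representation sends `H_w` to the basis vector
at `w`. -/
theorem linearIndependent_heckeStd : LinearIndependent ℤ[T;T⁻¹] cs.heckeStd := by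
  let φ : M.Hecke →ₗ[ℤ[T;T⁻¹]] (W →₀ ℤ[T;T⁻¹]) :=
    (LinearMap.applyₗ (Finsupp.single 1 1)).comp cs.regularRep.toLinearMap
  refine LinearIndependent.of_comp φ ?_
  have : φ ∘ cs.heckeStd = fun w => Finsupp.single w 1 := funext cs.regularRep_heckeStd
  rw [this]
  exact Finsupp.linearIndependent_single_one _ _

theorem span_heckeStd : ⊤ ≤ Submodule.span ℤ[T;T⁻¹] (Set.range cs.heckeStd) := by
  have key : ∀ a : M.Hecke, ∀ h ∈ Submodule.span ℤ[T;T⁻¹] (Set.range cs.heckeStd),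
      a * h ∈ Submodule.span ℤ[T;T⁻¹] (Set.range cs.heckeStd) := by
    intro a
    refine CoxeterMatrix.hecke_induction (p := fun a =>
      ∀ h ∈ Submodule.span ℤ[T;T⁻¹] (Set.range cs.heckeStd),
        a * h ∈ Submodule.span ℤ[T;T⁻¹] (Set.range cs.heckeStd)) a ?_ ?_ ?_ ?_
    · intro r h hh
      rw [← Algebra.smul_def]
      exact Submodule.smul_mem _ _ hh
    · intro i h hh
      induction hh using Submodule.span_induction with
      | mem x hx =>
        obtain ⟨w, rfl⟩ := hx
        by_cases hd : cs.IsLeftDescent w i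
        · rw [heckeGen_mul_heckeStd_of_isLeftDescent cs hd]
          exact Submodule.add_mem _ (Submodule.subset_span ⟨_, rfl⟩)
            (Submodule.smul_mem _ _ (Submodule.subset_span ⟨_, rfl⟩))
        · rw [heckeGen_mul_heckeStd_of_not cs hd]
          exact Submodule.subset_span ⟨_, rfl⟩
      | zero => simp
      | add x y _ _ hx hy => rw [mul_add]; exact Submodule.add_mem _ hx hy
      | smul r x _ hx => rw [mul_smul_comm]; exact Submodule.smul_mem _ _ hx
    · intro a b ha hb h hh
      rw [mul_assoc]
      exact ha _ (hb _ hh)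
    · intro a b ha hb h hh
      rw [add_mul]
      exact Submodule.add_mem _ (ha _ hh) (hb _ hh)
  intro h _
  have := key h 1 (Submodule.subset_span ⟨1, cs.heckeStd_one⟩)
  rwa [mul_one] at this

/-- The standard basis of the Hecke algebra. -/
def stdBasis : Module.Basis W ℤ[T;T⁻¹] M.Hecke :=
  Module.Basis.mk cs.linearIndependent_heckeStd cs.span_heckeStd

@[simp] theorem stdBasis_apply (w : W) : cs.stdBasis w = cs.heckeStd w := by
  simp [stdBasis]

theorem stdBasis_repr_heckeStd (w : W) :
    cs.stdBasis.repr (cs.heckeStd w) = Finsupp.single w 1 := by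
  rw [← stdBasis_apply, Module.Basis.repr_self]

end CoxeterSystem

/-! ### Positivity of exponents and the bar involution -/

/-- The additive subgroup `v ℤ[v]` of `ℤ[v, v⁻¹]`. -/
def LaurentPolynomial.strictPart : AddSubgroup ℤ[T;T⁻¹] where
  carrier := {r | ∀ n ≤ 0, r.coeff n = 0}
  zero_mem' := fun _ _ => by simp
  add_mem' := fun {a b} ha hb n hn => by
    rw [AddMonoidAlgebra.coeff_add, Finsupp.add_apply, ha n hn, hb n hn, add_zero]
  neg_mem' := fun {a} ha n hn => by
    rw [AddMonoidAlgebra.coeff_neg, Finsupp.neg_apply, ha n hn, neg_zero]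

namespace LaurentPolynomial

theorem coeff_T_mul (r : ℤ[T;T⁻¹]) (m n : ℤ) : (T m * r).coeff n = r.coeff (n - m) := by
  induction r using LaurentPolynomial.induction_on' with
  | add p q hp hq =>
    rw [mul_add, AddMonoidAlgebra.coeff_add, Finsupp.add_apply, hp, hq,
      AddMonoidAlgebra.coeff_add, Finsupp.add_apply]
  | C_mul_T k a =>
    have : T m * (C a * T k) = C a * T (m + k) := by rw [T_add]; ring
    rw [this, ← smul_eq_C_mul, ← smul_eq_C_mul]
    simp only [AddMonoidAlgebra.coeff_smul, Finsupp.smul_apply, T_apply]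
    congr 1
    split_ifs <;> first | rfl | omega

theorem coeff_C_mul (r : ℤ[T;T⁻¹]) (a : ℤ) (n : ℤ) : (C a * r).coeff n = a * r.coeff n := by
  rw [← smul_eq_C_mul, AddMonoidAlgebra.coeff_smul, Finsupp.smul_apply, smul_eq_mul]

theorem C_mul_mem_strictPart {r : ℤ[T;T⁻¹]} (h : r ∈ strictPart) (a : ℤ) : C a * r ∈ strictPart := by
  intro n hn
  rw [coeff_C_mul, h n hn, mul_zero]

theorem T_one_mul_toLaurent_mem_strictPart (q : Polynomial ℤ) :
    T 1 * Polynomial.toLaurent q ∈ strictPart := by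
  intro n hn
  rw [coeff_T_mul]
  by_contra h
  have h' : n - 1 ∈ (Polynomial.toLaurent q).coeff.support := Finsupp.mem_support_iff.mpr h
  rw [support_coeff_toLaurent] at h'
  simp at h'
  omega

theorem exists_eq_T_one_mul_toLaurent {r : ℤ[T;T⁻¹]} (h : r ∈ strictPart) :
    ∃ q : Polynomial ℤ, r = T 1 * Polynomial.toLaurent q := by
  refine ⟨∑ n ∈ r.coeff.support, Polynomial.C (r.coeff n) * Polynomial.X ^ (n - 1).toNat, ?_⟩
  rw [map_sum, Finset.mul_sum]
  nth_rw 1 [← AddMonoidAlgebra.sum_coeff_single r]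
  refine Finset.sum_congr rfl fun n hn => ?_
  have hn' : 0 < n := by
    by_contra hn'
    exact Finsupp.mem_support_iff.mp hn (h n (not_lt.mp hn'))
  rw [Polynomial.toLaurent_C_mul_X_pow, single_eq_C_mul_T, ← mul_assoc, mul_comm (T 1), mul_assoc,
    ← T_add]
  congr 2
  omega

theorem eq_zero_of_mem_strictPart_of_invert_eq {r : ℤ[T;T⁻¹]} (h : r ∈ strictPart)
    (h' : invert r = r) : r = 0 := by
  ext n
  rcases le_or_gt n 0 with hn | hn
  · simpa using h n hn
  · rw [← h', invert_apply, h (-n) (by omega)]; simp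

end LaurentPolynomial

namespace CoxeterMatrix

open LaurentPolynomial (T)

variable {B : Type*} {M : CoxeterMatrix B}

theorem heckeBar_smul (r : ℤ[T;T⁻¹]) (h : M.Hecke) :
    M.heckeBar (r • h) = LaurentPolynomial.invert r • M.heckeBar h := by
  rw [Algebra.smul_def, map_mul, heckeBar_algebraMap, ← Algebra.smul_def]

variable (M) in
/-- The Kazhdan-Lusztig basis element `H_i + v` of a simple reflection. -/
def klGen (i : B) : M.Hecke := M.heckeGen i + algebraMap _ _ (T 1 : ℤ[T;T⁻¹])

theorem heckeBar_klGen (i : B) : M.heckeBar (M.klGen i) = M.klGen i := by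
  rw [klGen, map_add, heckeBar_heckeGen, heckeBar_algebraMap, heckeGenInv, add_assoc, ← map_add]
  simp

theorem klGen_mul_self (i : B) :
    M.klGen i * M.klGen i = (T 1 + T (-1) : ℤ[T;T⁻¹]) • M.klGen i := by
  simp only [klGen, add_mul, mul_add, heckeGen_mul_self, ← Algebra.smul_def, ← Algebra.commutes,
    smul_add]
  have : (T (-1) * T 1 : ℤ[T;T⁻¹]) = 1 := by rw [← LaurentPolynomial.T_add]; simp
  simp only [Algebra.algebraMap_eq_smul_one, smul_smul, add_mul, this]
  module

end CoxeterMatrix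

namespace CoxeterSystem

open LaurentPolynomial (T strictPart)

variable {B W : Type*} [Group W] {M : CoxeterMatrix B} (cs : CoxeterSystem M W)

open Classical in
theorem repr_heckeGen_mul (i : B) (h : M.Hecke) (y : W) :
    cs.stdBasis.repr (M.heckeGen i * h) y = cs.stdBasis.repr h (cs.simple i * y) +
      if cs.IsLeftDescent y i then (T (-1) - T 1) * cs.stdBasis.repr h y else 0 := by
  have hmem := cs.span_heckeStd (Submodule.mem_top (x := h))
  induction hmem using Submodule.span_induction with
  | mem x hx =>
    obtain ⟨w, rfl⟩ := hx
    have e : cs.simple i * w = y ↔ w = cs.simple i * y := by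
      constructor
      · rintro rfl; simp
      · rintro rfl; simp
    by_cases hd : cs.IsLeftDescent w i
    · rw [heckeGen_mul_heckeStd_of_isLeftDescent cs hd]
      simp only [map_add, map_smul, stdBasis_repr_heckeStd, Finsupp.add_apply, Finsupp.smul_apply,
        Finsupp.single_apply, e]
      by_cases hwy : w = y
      · subst hwy; simp [hd]
      · simp [hwy]
    · rw [heckeGen_mul_heckeStd_of_not cs hd]
      simp only [stdBasis_repr_heckeStd, Finsupp.single_apply, e]
      by_cases hwy : w = y
      · subst hwy; simp [hd]
      · simp [hwy]
  | zero => simp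
  | add a b _ _ ha hb =>
    simp only [mul_add, map_add, Finsupp.add_apply, ha, hb]
    split_ifs <;> ring
  | smul r a _ ha =>
    simp only [mul_smul_comm, map_smul, Finsupp.smul_apply, ha, smul_eq_mul]
    split_ifs <;> ring

open Classical in
theorem repr_klGen_mul (i : B) (h : M.Hecke) (y : W) :
    cs.stdBasis.repr (M.klGen i * h) y = cs.stdBasis.repr h (cs.simple i * y) +
      (if cs.IsLeftDescent y i then T (-1) else T 1) * cs.stdBasis.repr h y := by
  rw [CoxeterMatrix.klGen, add_mul, ← Algebra.smul_def, map_add, Finsupp.add_apply,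
    repr_heckeGen_mul, map_smul, Finsupp.smul_apply, smul_eq_mul]
  split_ifs <;> ring

/-- The bar involution is unitriangular. Ordering by length suffices here and replaces the Bruhat
order throughout. -/
theorem repr_heckeBar_heckeStd {w y : W} (h : cs.length w ≤ cs.length y) :
    cs.stdBasis.repr (M.heckeBar (cs.heckeStd w)) y = Finsupp.single w (1 : ℤ[T;T⁻¹]) y := by
  classical
  obtain ⟨n, hn⟩ : ∃ n, n = cs.length w := ⟨_, rfl⟩
  induction n generalizing w y with
  | zero =>
    rw [cs.length_eq_zero_iff.mp hn.symm, heckeStd_one, map_one, ← heckeStd_one cs,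
      stdBasis_repr_heckeStd]
  | succ n ih =>
    have hw : w ≠ 1 := by rintro rfl; simp at hn
    obtain ⟨i, hi⟩ := cs.exists_leftDescent_of_ne_one hw
    have hl := cs.isLeftDescent_iff.mp hi
    have hi' : ¬ cs.IsLeftDescent (cs.simple i * w) i :=
      cs.isLeftDescent_iff_not_isLeftDescent_mul.mp hi
    have e := cs.heckeGen_mul_heckeStd_of_not hi'
    rw [simple_mul_simple_cancel_left] at e
    have hy := cs.length_simple_mul y i
    have h1 := ih (w := cs.simple i * w) (y := cs.simple i * y) (by omega) (by omega)
    have h2 := ih (w := cs.simple i * w) (y := y) (by omega) (by omega)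
    have hne : cs.simple i * w ≠ y := by rintro rfl; omega
    rw [Finsupp.single_apply, if_neg hne] at h2
    rw [← e, map_mul, CoxeterMatrix.heckeBar_heckeGen, CoxeterMatrix.heckeGenInv, add_mul,
      ← Algebra.smul_def, map_add, Finsupp.add_apply, repr_heckeGen_mul, map_smul,
      Finsupp.smul_apply, h1, h2]
    simp [Finsupp.single_apply]

theorem repr_heckeBar {h : M.Hecke} {y : W}
    (hy : ∀ z, cs.length y < cs.length z → cs.stdBasis.repr h z = 0) :
    cs.stdBasis.repr (M.heckeBar h) y = LaurentPolynomial.invert (cs.stdBasis.repr h y) := by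
  classical
  have e : h = (cs.stdBasis.repr h).sum fun z a => a • cs.heckeStd z := by
    conv_lhs => rw [← cs.stdBasis.linearCombination_repr h, Finsupp.linearCombination_apply]
    simp
  have e' : M.heckeBar h = (cs.stdBasis.repr h).sum fun z a =>
      LaurentPolynomial.invert a • M.heckeBar (cs.heckeStd z) := by
    conv_lhs => rw [e]
    rw [map_finsuppSum]
    simp only [CoxeterMatrix.heckeBar_smul]
  rw [e', map_finsuppSum, Finsupp.sum, Finsupp.finsetSum_apply]
  have : ∀ z ∈ (cs.stdBasis.repr h).support,
      cs.stdBasis.repr (LaurentPolynomial.invert (cs.stdBasis.repr h z) •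
        M.heckeBar (cs.heckeStd z)) y =
      if z = y then LaurentPolynomial.invert (cs.stdBasis.repr h y) else 0 := by
    intro z hz
    have hl : cs.length z ≤ cs.length y := by
      by_contra hl
      exact Finsupp.mem_support_iff.mp hz (hy z (not_le.mp hl))
    rw [map_smul, Finsupp.smul_apply, repr_heckeBar_heckeStd cs hl, Finsupp.single_apply]
    split_ifs with hzy
    · subst hzy; simp
    · simp
  rw [Finset.sum_congr rfl this, Finset.sum_ite_eq']
  split_ifs with hs
  · rfl
  · rw [Finsupp.notMem_support_iff.mp hs, map_zero]

/-- A coefficient at an element of maximal length is fixed by `v ↦ v⁻¹` and lies in `v ℤ[v]`, so it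
vanishes. This yields uniqueness of the Kazhdan-Lusztig basis. -/
theorem eq_zero_of_heckeBar_eq {h : M.Hecke} (hbar : M.heckeBar h = h)
    (hpos : ∀ y, cs.stdBasis.repr h y ∈ strictPart) : h = 0 := by
  by_contra hne
  have hne' : (cs.stdBasis.repr h).support.Nonempty := by
    rw [Finsupp.support_nonempty_iff]
    simpa using hne
  obtain ⟨y, hy, hmax⟩ := Finset.exists_max_image _ cs.length hne'
  refine Finsupp.mem_support_iff.mp hy
    (LaurentPolynomial.eq_zero_of_mem_strictPart_of_invert_eq (hpos y) ?_)
  rw [← cs.repr_heckeBar, hbar]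
  intro z hz
  by_contra hz'
  exact absurd (hmax z (Finsupp.mem_support_iff.mpr hz')) (not_le.mpr hz)

/-! ### The Kazhdan-Lusztig basis -/

/-- A bar-invariant element with leading term `H_w`, whose other terms have coefficients in `v ℤ[v]`
and are attached to elements that are shorter than `w`. -/
structure IsTriangularKL (w : W) (c : M.Hecke) : Prop where
  bar : M.heckeBar c = c
  pos : ∀ y, cs.stdBasis.repr c y - Finsupp.single w (1 : ℤ[T;T⁻¹]) y ∈ strictPart
  eq_single : ∀ y, cs.length w ≤ cs.length y →
    cs.stdBasis.repr c y = Finsupp.single w (1 : ℤ[T;T⁻¹]) y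

variable {cs}

theorem IsKLElement.pos {w : W} {c : M.Hecke} (h : cs.IsKLElement w c) (y : W) :
    cs.stdBasis.repr c y - Finsupp.single w (1 : ℤ[T;T⁻¹]) y ∈ strictPart := by
  classical
  obtain ⟨-, p, rfl⟩ := h
  rw [map_add, Finsupp.add_apply, stdBasis_repr_heckeStd, add_sub_cancel_left, map_finsuppSum,
    Finsupp.sum, Finsupp.finsetSum_apply]
  refine sum_mem fun z _ => ?_
  rw [map_smul, stdBasis_repr_heckeStd, Finsupp.smul_apply, Finsupp.single_apply]
  split_ifs
  · rw [smul_eq_mul, mul_one]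
    exact LaurentPolynomial.T_one_mul_toLaurent_mem_strictPart _
  · rw [smul_zero]; exact zero_mem _

theorem IsKLElement.unique {w : W} {c c' : M.Hecke} (h : cs.IsKLElement w c)
    (h' : cs.IsKLElement w c') : c = c' := by
  rw [← sub_eq_zero]
  refine cs.eq_zero_of_heckeBar_eq (by rw [map_sub, h.1, h'.1]) fun y => ?_
  have := sub_mem (h.pos y) (h'.pos y)
  rwa [sub_sub_sub_cancel_right, ← Finsupp.sub_apply, ← map_sub] at this

theorem IsTriangularKL.isKLElement {w : W} {c : M.Hecke} (h : cs.IsTriangularKL w c) :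
    cs.IsKLElement w c := by
  classical
  refine ⟨h.bar, ?_⟩
  have hpos : ∀ y, ∃ q : Polynomial ℤ, cs.stdBasis.repr (c - cs.heckeStd w) y =
      T 1 * Polynomial.toLaurent q := by
    intro y
    refine LaurentPolynomial.exists_eq_T_one_mul_toLaurent ?_
    rw [map_sub, stdBasis_repr_heckeStd]
    exact h.pos y
  choose q hq using hpos
  refine ⟨Finsupp.onFinset (cs.stdBasis.repr (c - cs.heckeStd w)).support q fun y hy => ?_, ?_⟩
  · rw [Finsupp.mem_support_iff, hq]
    intro h0
    have := (LaurentPolynomial.isUnit_T (R := ℤ) 1).mul_right_eq_zero.mp h0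
    exact hy (Polynomial.toLaurent_eq_zero.mp this)
  · rw [Finsupp.onFinset_sum]
    · rw [← sub_eq_iff_eq_add']
      conv_lhs => rw [← cs.stdBasis.linearCombination_repr (c - cs.heckeStd w),
        Finsupp.linearCombination_apply, Finsupp.sum]
      refine Finset.sum_congr rfl fun y _ => ?_
      rw [hq, stdBasis_apply]
    · simp

end CoxeterSystem

/-! ### Existence of the Kazhdan-Lusztig basis and multiplication formulas -/

namespace CoxeterSystem

open LaurentPolynomial (T strictPart)

variable {B W : Type*} [Group W] {M : CoxeterMatrix B} (cs : CoxeterSystem M W)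

open Classical in
/-- The coefficients `μ(z, h)` of `v` in the coordinates of `h`, for those `z` that are shorter than
`n` and have `i` as a left descent. -/
def muCoeff (i : B) (n : ℕ) (h : M.Hecke) : W →₀ ℤ[T;T⁻¹] :=
  ((cs.stdBasis.repr h).filter fun z => cs.IsLeftDescent z i ∧ cs.length z < n).mapRange
    (fun r => LaurentPolynomial.C (r.coeff 1)) (by simp)

open Classical in
theorem muCoeff_apply (i : B) (n : ℕ) (h : M.Hecke) (z : W) :
    cs.muCoeff i n h z = if cs.IsLeftDescent z i ∧ cs.length z < n then
      LaurentPolynomial.C ((cs.stdBasis.repr h z).coeff 1) else 0 := by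
  rw [muCoeff, Finsupp.mapRange_apply, Finsupp.filter_apply]
  split_ifs <;> simp

theorem of_muCoeff_ne_zero {i : B} {n : ℕ} {h : M.Hecke} {z : W} (hz : cs.muCoeff i n h z ≠ 0) :
    cs.IsLeftDescent z i ∧ cs.length z < n ∧ (cs.stdBasis.repr h z).coeff 1 ≠ 0 ∧
      cs.muCoeff i n h z = LaurentPolynomial.C ((cs.stdBasis.repr h z).coeff 1) := by
  classical
  rw [muCoeff_apply] at hz ⊢
  split_ifs at hz ⊢ with hc
  · refine ⟨hc.1, hc.2, fun h0 => ?_, rfl⟩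
    rw [h0, map_zero] at hz
    exact hz rfl
  · exact absurd rfl hz

theorem repr_finsuppSum (f : W →₀ ℤ[T;T⁻¹]) (C : W → M.Hecke) (y : W) :
    cs.stdBasis.repr (f.sum fun z a => a • C z) y =
      ∑ z ∈ f.support, f z * cs.stdBasis.repr (C z) y := by
  rw [map_finsuppSum, Finsupp.sum, Finsupp.finsetSum_apply]
  simp

variable {cs}

/-- Multiplication by `H_i + v` preserves bar-invariance but creates constant terms at those `y`
with left descent `i`, where the coefficient is multiplied by `v⁻¹`. These are the integers `μ`, and
subtracting `μ C_y` removes them without losing bar-invariance. -/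
theorem IsTriangularKL.klGen_mul_sub {w : W} {c : M.Hecke} (hc : cs.IsTriangularKL w c) {i : B}
    (hi : ¬ cs.IsLeftDescent w i) {C : W → M.Hecke}
    (hC : ∀ z, cs.length z < cs.length w → cs.IsTriangularKL z (C z)) :
    cs.IsTriangularKL (cs.simple i * w) (M.klGen i * c -
      (cs.muCoeff i (cs.length w) c).sum fun z a => a • C z) := by
  classical
  have hl := cs.not_isLeftDescent_iff.mp hi
  have hsupp : ∀ z ∈ (cs.muCoeff i (cs.length w) c).support, cs.IsTriangularKL z (C z) := by
    intro z hz
    exact hC z (cs.of_muCoeff_ne_zero (Finsupp.mem_support_iff.mp hz)).2.1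
  have e : ∀ y, w = cs.simple i * y ↔ cs.simple i * w = y := by
    intro y
    constructor
    · rintro rfl; simp
    · rintro rfl; simp
  refine ⟨?_, fun y => ?_, fun y hy => ?_⟩
  · rw [map_sub, map_mul, CoxeterMatrix.heckeBar_klGen, hc.bar, map_finsuppSum]
    congr 1
    refine Finset.sum_congr rfl fun z hz => ?_
    simp only [CoxeterMatrix.heckeBar_smul]
    rw [(hsupp z hz).bar,
      (cs.of_muCoeff_ne_zero (Finsupp.mem_support_iff.mp hz)).2.2.2, LaurentPolynomial.invert_C]
  · have h1 := hc.pos (cs.simple i * y)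
    rw [Finsupp.single_apply, e y, ← Finsupp.single_apply] at h1
    have h2 : (cs.muCoeff i (cs.length w) c).sum
        (fun z a => a * (cs.stdBasis.repr (C z) y - Finsupp.single z (1 : ℤ[T;T⁻¹]) y)) ∈
          strictPart := by
      refine sum_mem fun z hz => ?_
      rw [(cs.of_muCoeff_ne_zero (Finsupp.mem_support_iff.mp hz)).2.2.2]
      exact LaurentPolynomial.C_mul_mem_strictPart ((hsupp z hz).pos y) _
    have h3 : (cs.muCoeff i (cs.length w) c).sum
        (fun z a => a * Finsupp.single z (1 : ℤ[T;T⁻¹]) y) = cs.muCoeff i (cs.length w) c y := by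
      simp +contextual [Finsupp.sum, Finsupp.single_apply, eq_comm]
    have h4 : (if cs.IsLeftDescent y i then T (-1) else T 1) * cs.stdBasis.repr c y -
        cs.muCoeff i (cs.length w) c y ∈ strictPart := by
      by_cases hy : cs.IsLeftDescent y i
      · have hyw : w ≠ y := by rintro rfl; exact hi hy
        have hp := hc.pos y
        rw [Finsupp.single_apply, if_neg hyw, sub_zero] at hp
        rw [muCoeff_apply]
        simp only [hy, if_true, true_and]
        split_ifs with hlen
        · intro n hn
          rw [AddMonoidAlgebra.coeff_sub, Finsupp.sub_apply, LaurentPolynomial.coeff_T_mul,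
            LaurentPolynomial.C_apply]
          rcases eq_or_ne n 0 with rfl | hn0
          · simp
          · rw [if_neg hn0, hp _ (by omega), sub_zero]
        · have := hc.eq_single y (by omega)
          rw [Finsupp.single_apply, if_neg hyw] at this
          rw [this]; simp [zero_mem]
      · rw [muCoeff_apply]
        simp only [hy, if_false, false_and, sub_zero]
        intro n hn
        rw [LaurentPolynomial.coeff_T_mul]
        have hp := hc.pos y (n - 1) (by omega)
        rw [AddMonoidAlgebra.coeff_sub, Finsupp.sub_apply, sub_eq_zero] at hp
        rw [hp, Finsupp.single_apply]
        split_ifs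
        · rw [← LaurentPolynomial.T_zero, LaurentPolynomial.T_apply, if_neg (by omega)]
        · simp
    have h5 := sub_mem (add_mem h1 h4) h2
    simp only [mul_sub, Finsupp.sum_sub, h3] at h5
    rw [map_sub, Finsupp.sub_apply, repr_klGen_mul, repr_finsuppSum]
    rw [Finsupp.sum] at h5
    convert h5 using 1
    ring
  · rw [hl] at hy
    have hly := cs.length_simple_mul y i
    have hne : w ≠ y := by rintro rfl; omega
    rw [map_sub, Finsupp.sub_apply, repr_klGen_mul, repr_finsuppSum,
      hc.eq_single y (by omega), hc.eq_single (cs.simple i * y) (by omega),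
      Finset.sum_eq_zero, Finsupp.single_apply, Finsupp.single_apply, Finsupp.single_apply,
      if_neg hne, mul_zero, add_zero, sub_zero]
    · simp only [e y]
    · intro z hz
      have hz' := (cs.of_muCoeff_ne_zero (Finsupp.mem_support_iff.mp hz)).2.1
      have hne : z ≠ y := by rintro rfl; omega
      rw [(hsupp z hz).eq_single y (by omega), Finsupp.single_apply, if_neg hne, mul_zero]

variable (cs)

theorem exists_isTriangularKL (w : W) : ∃ c, cs.IsTriangularKL w c := by
  classical
  obtain ⟨n, hn⟩ : ∃ n, n = cs.length w := ⟨_, rfl⟩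
  induction n using Nat.strong_induction_on generalizing w with
  | _ n ih =>
    rcases eq_or_ne w 1 with rfl | hw
    · refine ⟨cs.heckeStd 1, ?_, fun y => ?_, fun y _ => ?_⟩
      · rw [heckeStd_one, map_one]
      · rw [stdBasis_repr_heckeStd, sub_self]; exact zero_mem _
      · rw [stdBasis_repr_heckeStd]
    · obtain ⟨i, hi⟩ := cs.exists_leftDescent_of_ne_one hw
      have hl := cs.isLeftDescent_iff.mp hi
      have hi' : ¬ cs.IsLeftDescent (cs.simple i * w) i :=
        cs.isLeftDescent_iff_not_isLeftDescent_mul.mp hi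
      obtain ⟨c, hc⟩ := ih _ (by omega) (cs.simple i * w) rfl
      have hC : ∀ z, ∃ c, cs.length z < cs.length (cs.simple i * w) → cs.IsTriangularKL z c := by
        intro z
        by_cases hz : cs.length z < cs.length (cs.simple i * w)
        · obtain ⟨c, hc⟩ := ih _ (by omega) z rfl
          exact ⟨c, fun _ => hc⟩
        · exact ⟨0, fun h => absurd h hz⟩
      choose C hC using hC
      have := hc.klGen_mul_sub hi' hC
      rw [simple_mul_simple_cancel_left] at this
      exact ⟨_, this⟩

theorem isKLElement_klBasis (w : W) : cs.IsKLElement w (cs.klBasis w) := by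
  obtain ⟨c, hc⟩ := cs.exists_isTriangularKL w
  exact Classical.epsilon_spec (p := cs.IsKLElement w) ⟨c, hc.isKLElement⟩

variable {cs} in
theorem IsTriangularKL.eq_klBasis {w : W} {c : M.Hecke} (hc : cs.IsTriangularKL w c) :
    c = cs.klBasis w :=
  hc.isKLElement.unique (cs.isKLElement_klBasis w)

theorem isTriangularKL_klBasis (w : W) : cs.IsTriangularKL w (cs.klBasis w) := by
  obtain ⟨c, hc⟩ := cs.exists_isTriangularKL w
  rwa [← hc.eq_klBasis]

theorem klBasis_one : cs.klBasis 1 = 1 := by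
  refine (IsTriangularKL.eq_klBasis (cs := cs) ⟨map_one _, fun y => ?_, fun y _ => ?_⟩).symm
  · rw [← heckeStd_one cs, stdBasis_repr_heckeStd, sub_self]; exact zero_mem _
  · rw [← heckeStd_one cs, stdBasis_repr_heckeStd]

/-- The multiplication formula for a simple reflection that is not a left descent. -/
theorem klGen_mul_klBasis_of_not {w : W} {i : B} (hi : ¬ cs.IsLeftDescent w i) :
    M.klGen i * cs.klBasis w = cs.klBasis (cs.simple i * w) +
      (cs.muCoeff i (cs.length w) (cs.klBasis w)).sum fun z a => a • cs.klBasis z := by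
  rw [← ((cs.isTriangularKL_klBasis w).klGen_mul_sub hi
    fun z _ => cs.isTriangularKL_klBasis z).eq_klBasis, sub_add_cancel]

theorem klBasis_simple (i : B) : cs.klBasis (cs.simple i) = M.klGen i := by
  have h := cs.klGen_mul_klBasis_of_not (cs.not_isLeftDescent_one i)
  have h0 : cs.muCoeff i (cs.length (1 : W)) (cs.klBasis 1) = 0 := by
    ext1 z
    by_contra hz
    have := (cs.of_muCoeff_ne_zero hz).2.1
    simp at this
  rw [h0, Finsupp.sum_zero_index, add_zero, klBasis_one, mul_one, mul_one] at h
  exact h.symm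

/-- The multiplication formula for a simple reflection that is a left descent. -/
theorem klGen_mul_klBasis_of_isLeftDescent {w : W} {i : B} (hi : cs.IsLeftDescent w i) :
    M.klGen i * cs.klBasis w = (T 1 + T (-1) : ℤ[T;T⁻¹]) • cs.klBasis w := by
  obtain ⟨n, hn⟩ : ∃ n, n = cs.length w := ⟨_, rfl⟩
  induction n using Nat.strong_induction_on generalizing w with
  | _ n ih =>
    have hl := cs.isLeftDescent_iff.mp hi
    have hi' : ¬ cs.IsLeftDescent (cs.simple i * w) i :=
      cs.isLeftDescent_iff_not_isLeftDescent_mul.mp hi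
    have h := cs.klGen_mul_klBasis_of_not hi'
    rw [simple_mul_simple_cancel_left, ← sub_eq_iff_eq_add] at h
    -- All correction terms are shorter and have `i` as a left descent, so induction makes them
    -- eigenvectors too; `C_i ^ 2 = (v + v⁻¹) C_i` handles the rest.
    have hsum : (M.klGen i * (cs.muCoeff i (cs.length (cs.simple i * w))
        (cs.klBasis (cs.simple i * w))).sum fun z a => a • cs.klBasis z) =
        (T 1 + T (-1) : ℤ[T;T⁻¹]) • (cs.muCoeff i (cs.length (cs.simple i * w))
        (cs.klBasis (cs.simple i * w))).sum fun z a => a • cs.klBasis z := by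
      rw [Finsupp.sum, Finset.mul_sum, Finset.smul_sum]
      refine Finset.sum_congr rfl fun z hz => ?_
      have hz' := cs.of_muCoeff_ne_zero (Finsupp.mem_support_iff.mp hz)
      rw [mul_smul_comm, ih _ (by omega) hz'.1 rfl, smul_comm]
    rw [← h, mul_sub, ← mul_assoc, CoxeterMatrix.klGen_mul_self, smul_mul_assoc, hsum, smul_sub]

-- Comparing coefficients of `H_y` in `C_i C_w = (v + v⁻¹) C_w` gives `h_{s_i y} = v⁻¹ h_y`, where
-- `h_z` is the coefficient of `H_z` in `C_w`. So `μ(y, w)` is the constant term of `h_{s_i y}`.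
open Classical in
theorem coeff_one_repr_klBasis {w y : W} {i : B} (hw : cs.IsLeftDescent w i)
    (hy : ¬ cs.IsLeftDescent y i) :
    (cs.stdBasis.repr (cs.klBasis w) y).coeff 1 = if cs.simple i * y = w then 1 else 0 := by
  classical
  have h := congrArg (fun h => cs.stdBasis.repr h y) (cs.klGen_mul_klBasis_of_isLeftDescent hw)
  simp only [repr_klGen_mul, hy, if_false, map_smul, Finsupp.smul_apply, smul_eq_mul,
    add_mul] at h
  rw [add_comm, add_right_inj] at h
  have h' := congrArg (fun r : ℤ[T;T⁻¹] => r.coeff 0) h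
  simp only [LaurentPolynomial.coeff_T_mul] at h'
  have hp := (cs.isTriangularKL_klBasis w).pos (cs.simple i * y) 0 le_rfl
  rw [AddMonoidAlgebra.coeff_sub, Finsupp.sub_apply, sub_eq_zero] at hp
  rw [show (0 : ℤ) - -1 = 1 by norm_num] at h'
  rw [← h', hp, Finsupp.single_apply]
  simp only [eq_comm (a := w)]
  split_ifs
  · rw [← LaurentPolynomial.T_zero, LaurentPolynomial.T_apply, if_pos rfl]
  · simp

/-- Makes the expansion in `AppearsIn` unique, so that membership in a span controls which elements
appear. -/
theorem linearIndependent_klBasis : LinearIndependent ℤ[T;T⁻¹] cs.klBasis := by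
  classical
  rw [linearIndependent_iff]
  intro f hf
  by_contra hne
  obtain ⟨y, hy, hmax⟩ := Finset.exists_max_image _ cs.length (Finsupp.support_nonempty_iff.mpr hne)
  have h := congrArg (fun h => cs.stdBasis.repr h y) hf
  simp only [Finsupp.linearCombination_apply, repr_finsuppSum, map_zero,
    Finsupp.zero_apply] at h
  rw [Finset.sum_congr rfl (g := fun z => if z = y then f y else 0)] at h
  · rw [Finset.sum_ite_eq', if_pos hy] at h
    exact Finsupp.mem_support_iff.mp hy h
  · intro z hz
    rw [(cs.isTriangularKL_klBasis z).eq_single y (hmax z hz), Finsupp.single_apply]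
    split_ifs with hzy
    · subst hzy; simp
    · simp

end CoxeterSystem

/-! ### The anti-involution -/

namespace CoxeterMatrix

variable {B : Type*} (M : CoxeterMatrix B)

open MulOpposite

theorem heckeRev_rel ⦃x y : FreeAlgebra ℤ[T;T⁻¹] B⦄ (h : M.HeckeRel x y) :
    FreeAlgebra.lift ℤ[T;T⁻¹] (fun i => op (M.heckeGen i)) x =
      FreeAlgebra.lift ℤ[T;T⁻¹] (fun i => op (M.heckeGen i)) y := by
  cases h with
  | quadratic i =>
    simp only [map_mul, map_add, map_one, map_smul, FreeAlgebra.lift_ι_apply, ← op_mul,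
      heckeGen_mul_self]
    rfl
  | braid i j =>
    simp only [map_list_prod, List.map_map]
    have e : (FreeAlgebra.lift ℤ[T;T⁻¹] (fun i => op (M.heckeGen i)) ∘ FreeAlgebra.ι ℤ[T;T⁻¹]) =
        op ∘ M.heckeGen := funext fun i => FreeAlgebra.lift_ι_apply _ i
    have e' : ∀ ω : List B, (ω.map (op ∘ M.heckeGen)).prod =
        op ((ω.reverse.map M.heckeGen).prod) := by
      intro ω
      rw [op_list_prod, List.map_map, List.map_reverse, List.reverse_reverse]
    rw [e, e', e', reverse_alternatingWord, reverse_alternatingWord]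
    split_ifs
    · rw [M.heckeGen_braid i j]
    · rw [M.heckeGen_braid i j]

/-- The anti-involution of the Hecke algebra that fixes the generators, as a homomorphism to the
opposite algebra. -/
def heckeRevHom : M.Hecke →ₐ[ℤ[T;T⁻¹]] M.Heckeᵐᵒᵖ :=
  RingQuot.liftAlgHom _ ⟨FreeAlgebra.lift ℤ[T;T⁻¹] fun i => op (M.heckeGen i), M.heckeRev_rel⟩

/-- The anti-involution of the Hecke algebra that fixes the generators. -/
def heckeRev (h : M.Hecke) : M.Hecke := unop (M.heckeRevHom h)

theorem heckeRev_heckeGen (i : B) : M.heckeRev (M.heckeGen i) = M.heckeGen i := by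
  have := RingQuot.liftAlgHom_mkAlgHom_apply ℤ[T;T⁻¹]
    (FreeAlgebra.lift ℤ[T;T⁻¹] fun i => op (M.heckeGen i)) M.heckeRev_rel (FreeAlgebra.ι _ i)
  rw [FreeAlgebra.lift_ι_apply] at this
  exact congrArg unop this

theorem heckeRev_mul (a b : M.Hecke) : M.heckeRev (a * b) = M.heckeRev b * M.heckeRev a := by
  simp [heckeRev]

theorem heckeRev_add (a b : M.Hecke) : M.heckeRev (a + b) = M.heckeRev a + M.heckeRev b := by
  simp [heckeRev]

theorem heckeRev_smul (r : ℤ[T;T⁻¹]) (a : M.Hecke) : M.heckeRev (r • a) = r • M.heckeRev a := by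
  simp [heckeRev]

theorem heckeRev_one : M.heckeRev 1 = 1 := by
  simp [heckeRev]

theorem heckeRev_algebraMap (r : ℤ[T;T⁻¹]) :
    M.heckeRev (algebraMap _ _ r) = algebraMap _ _ r := by
  rw [Algebra.algebraMap_eq_smul_one, heckeRev_smul, heckeRev_one]

theorem heckeRev_sum {ι : Type*} (s : Finset ι) (f : ι → M.Hecke) :
    M.heckeRev (∑ i ∈ s, f i) = ∑ i ∈ s, M.heckeRev (f i) := by
  simp [heckeRev]

theorem heckeBar_heckeRev (h : M.Hecke) : M.heckeBar (M.heckeRev h) = M.heckeRev (M.heckeBar h) := by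
  induction h using hecke_induction with
  | scalar r => rw [heckeRev_algebraMap, heckeBar_algebraMap, heckeRev_algebraMap]
  | gen i => rw [heckeRev_heckeGen, heckeBar_heckeGen, heckeGenInv, heckeRev_add, heckeRev_heckeGen,
      heckeRev_algebraMap]
  | mul a b ha hb => rw [heckeRev_mul, map_mul, map_mul, heckeRev_mul, ha, hb]
  | add a b ha hb => rw [heckeRev_add, map_add, map_add, heckeRev_add, ha, hb]

end CoxeterMatrix

namespace CoxeterSystem

variable {B W : Type*} [Group W] {M : CoxeterMatrix B} (cs : CoxeterSystem M W)

theorem heckeRev_heckeStd (w : W) : M.heckeRev (cs.heckeStd w) = cs.heckeStd w⁻¹ := by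
  obtain ⟨ω, r, rfl⟩ := cs.exists_isReduced w
  rw [← wordProd_reverse, heckeStd_wordProd cs r, heckeStd_wordProd cs r.reverse]
  clear r
  induction ω with
  | nil => simp [CoxeterMatrix.heckeRev_one]
  | cons i ω ih =>
    simp [CoxeterMatrix.heckeRev_mul, ih, CoxeterMatrix.heckeRev_heckeGen]

theorem repr_heckeRev (h : M.Hecke) (y : W) :
    cs.stdBasis.repr (M.heckeRev h) y = cs.stdBasis.repr h y⁻¹ := by
  classical
  have hmem := cs.span_heckeStd (Submodule.mem_top (x := h))
  induction hmem using Submodule.span_induction with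
  | mem x hx =>
    obtain ⟨w, rfl⟩ := hx
    simp only [heckeRev_heckeStd, stdBasis_repr_heckeStd, Finsupp.single_apply, inv_eq_iff_eq_inv]
  | zero =>
    have : M.heckeRev 0 = 0 := by simp [CoxeterMatrix.heckeRev]
    simp [this]
  | add a b _ _ ha hb =>
    simp only [CoxeterMatrix.heckeRev_add, map_add, Finsupp.add_apply, ha, hb]
  | smul r a _ ha =>
    simp only [CoxeterMatrix.heckeRev_smul, map_smul, Finsupp.smul_apply, ha]

theorem heckeRev_klBasis (w : W) : M.heckeRev (cs.klBasis w) = cs.klBasis w⁻¹ := by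
  classical
  have h := cs.isTriangularKL_klBasis w
  refine IsTriangularKL.eq_klBasis ⟨?_, fun y => ?_, fun y hy => ?_⟩
  · rw [CoxeterMatrix.heckeBar_heckeRev, h.bar]
  · have := h.pos y⁻¹
    rw [repr_heckeRev]
    simpa only [Finsupp.single_apply, inv_eq_iff_eq_inv] using this
  · rw [length_inv] at hy
    rw [repr_heckeRev, h.eq_single _ (by rwa [length_inv])]
    simp only [Finsupp.single_apply, inv_eq_iff_eq_inv]

end CoxeterSystem

namespace CoxeterSystem

variable {B W : Type*} [Group W] {M : CoxeterMatrix B} (cs : CoxeterSystem M W)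

/-! ### The two-sided preorder -/

theorem appearsIn_klGen_mul {w y : W} {i : B} (hi : ¬ cs.IsLeftDescent w i)
    (hy : (Finsupp.single (cs.simple i * w) 1 +
      cs.muCoeff i (cs.length w) (cs.klBasis w) : W →₀ ℤ[T;T⁻¹]) y ≠ 0) :
    cs.AppearsIn y (M.klGen i * cs.klBasis w) := by
  refine ⟨_, ?_, hy⟩
  rw [Finsupp.sum_add_index' (by simp) (by simp [add_smul]), Finsupp.sum_single_index (by simp),
    one_smul, klGen_mul_klBasis_of_not cs hi]

theorem appearsIn_simple_mul {w : W} {i : B} (hi : ¬ cs.IsLeftDescent w i) :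
    cs.AppearsIn (cs.simple i * w) (M.klGen i * cs.klBasis w) := by
  refine cs.appearsIn_klGen_mul hi ?_
  have hl := cs.not_isLeftDescent_iff.mp hi
  have : cs.muCoeff i (cs.length w) (cs.klBasis w) (cs.simple i * w) = 0 := by
    by_contra h
    have := (cs.of_muCoeff_ne_zero h).2.1
    omega
  rw [Finsupp.add_apply, this, Finsupp.single_eq_same, add_zero]
  exact one_ne_zero

theorem twoSidedLE_simple_mul {w : W} {i : B} (hi : ¬ cs.IsLeftDescent w i) :
    cs.TwoSidedLE w (cs.simple i * w) := by
  refine Relation.ReflTransGen.single ⟨cs.simple i, 1, ?_⟩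
  rw [klBasis_one, mul_one, klBasis_simple]
  exact cs.appearsIn_simple_mul hi

theorem TwoSidedLE.inv {x y : W} (h : cs.TwoSidedLE x y) : cs.TwoSidedLE x⁻¹ y⁻¹ := by
  refine Relation.ReflTransGen.lift (·⁻¹) ?_ _ _ h
  rintro x y ⟨a, b, f, hf, hy⟩
  refine ⟨b⁻¹, a⁻¹, f.equivMapDomain (Equiv.inv W), ?_, ?_⟩
  · have := congrArg M.heckeRev hf
    rw [CoxeterMatrix.heckeRev_mul, CoxeterMatrix.heckeRev_mul, Finsupp.sum,
      CoxeterMatrix.heckeRev_sum] at this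
    simp only [CoxeterMatrix.heckeRev_smul, heckeRev_klBasis] at this
    rw [Finsupp.sum_equivMapDomain, mul_assoc, this]
    rfl
  · simpa [Finsupp.equivMapDomain_apply] using hy

/-- A set that is stable under inversion and under left multiplication by simple reflections (in the
Kazhdan-Lusztig basis) is an upper set for the two-sided preorder. -/
theorem TwoSidedLE.mem {A : Set W} (hinv : ∀ w ∈ A, w⁻¹ ∈ A)
    (hA : ∀ w ∈ A, ∀ i, ¬ cs.IsLeftDescent w i → cs.simple i * w ∈ A ∧
      ∀ y, cs.muCoeff i (cs.length w) (cs.klBasis w) y ≠ 0 → y ∈ A)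
    {x y : W} (h : cs.TwoSidedLE x y) (hx : x ∈ A) : y ∈ A := by
  obtain ⟨S, hS⟩ : ∃ S, S = Submodule.span ℤ[T;T⁻¹] (cs.klBasis '' A) := ⟨_, rfl⟩
  have hbasis : ∀ w ∈ A, cs.klBasis w ∈ S := fun w hw => hS ▸ Submodule.subset_span ⟨w, hw, rfl⟩
  have hgen : ∀ i, ∀ c ∈ S, M.klGen i * c ∈ S := by
    intro i c hc
    rw [hS] at hc
    induction hc using Submodule.span_induction with
    | mem c hc =>
      obtain ⟨w, hw, rfl⟩ := hc
      by_cases hi : cs.IsLeftDescent w i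
      · rw [klGen_mul_klBasis_of_isLeftDescent cs hi]
        exact S.smul_mem _ (hbasis w hw)
      · rw [klGen_mul_klBasis_of_not cs hi]
        obtain ⟨h1, h2⟩ := hA w hw i hi
        refine S.add_mem (hbasis _ h1) (S.sum_mem fun z hz => S.smul_mem _ (hbasis _ ?_))
        exact h2 z (Finsupp.mem_support_iff.mp hz)
    | zero => rw [mul_zero]; exact S.zero_mem
    | add a b _ _ ha hb => rw [mul_add]; exact S.add_mem ha hb
    | smul r a _ ha => rw [mul_smul_comm]; exact S.smul_mem _ ha
  have hleft : ∀ a : M.Hecke, ∀ c ∈ S, a * c ∈ S := by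
    intro a
    refine CoxeterMatrix.hecke_induction (p := fun a => ∀ c ∈ S, a * c ∈ S) a ?_ ?_ ?_ ?_
    · intro r c hc
      rw [← Algebra.smul_def]
      exact S.smul_mem _ hc
    · intro i c hc
      have := S.sub_mem (hgen i c hc) (S.smul_mem (LaurentPolynomial.T 1 : ℤ[T;T⁻¹]) hc)
      rwa [CoxeterMatrix.klGen, add_mul, ← Algebra.smul_def, add_sub_cancel_right] at this
    · intro a b ha hb c hc
      rw [mul_assoc]
      exact ha _ (hb _ hc)
    · intro a b ha hb c hc
      rw [add_mul]
      exact S.add_mem (ha _ hc) (hb _ hc)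
  have hrev : ∀ c ∈ S, M.heckeRev c ∈ S := by
    intro c hc
    rw [hS] at hc
    induction hc using Submodule.span_induction with
    | mem c hc =>
      obtain ⟨w, hw, rfl⟩ := hc
      rw [heckeRev_klBasis]
      exact hbasis _ (hinv w hw)
    | zero =>
      have : M.heckeRev 0 = 0 := by simp [CoxeterMatrix.heckeRev]
      rw [this]; exact S.zero_mem
    | add a b _ _ ha hb => rw [CoxeterMatrix.heckeRev_add]; exact S.add_mem ha hb
    | smul r a _ ha => rw [CoxeterMatrix.heckeRev_smul]; exact S.smul_mem _ ha
  -- Right multiplication is left multiplication conjugated by the anti-involution, which preserves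
  -- the span because `A` is stable under inversion.
  have hright : ∀ c ∈ S, ∀ b : W, c * cs.klBasis b ∈ S := by
    intro c hc b
    have := hrev _ (hleft (cs.klBasis b⁻¹) _ (hrev c hc))
    rw [CoxeterMatrix.heckeRev_mul, heckeRev_klBasis, inv_inv] at this
    suffices h : M.heckeRev (M.heckeRev c) = c by rwa [h] at this
    apply cs.stdBasis.repr.injective
    ext1 y
    rw [repr_heckeRev, repr_heckeRev, inv_inv]
  induction h with
  | refl => exact hx
  | tail _ hbc ih =>
    obtain ⟨a, b, f, hf, hy⟩ := hbc
    have hm := hright _ (hleft (cs.klBasis a) _ (hbasis _ ih)) b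
    rw [hf, hS] at hm
    obtain ⟨l, hl, hl'⟩ := (Finsupp.mem_span_image_iff_linearCombination _).mp hm
    have : l = f := cs.linearIndependent_klBasis hl'
    subst this
    exact (Finsupp.mem_supported _ _).mp hl (Finsupp.mem_support_iff.mpr hy)

theorem TwoSidedLE.ne_one {x y : W} (h : cs.TwoSidedLE x y) (hx : x ≠ 1) : y ≠ 1 := by
  refine TwoSidedLE.mem cs (A := {w | w ≠ 1}) ?_ ?_ h hx
  · intro w hw
    exact inv_ne_one.mpr hw
  · intro w _ i hi
    constructor
    · intro h1
      have := cs.not_isLeftDescent_iff.mp hi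
      rw [h1, length_one] at this
      omega
    · rintro y hy rfl
      exact cs.not_isLeftDescent_one i (cs.of_muCoeff_ne_zero hy).1

theorem HasUniqueReduced.of_simple_mul {w : W} {i : B} (hi : ¬ cs.IsLeftDescent w i)
    (h : cs.HasUniqueReduced (cs.simple i * w)) : cs.HasUniqueReduced w := by
  intro ω ω' r r' e e'
  have hc : ∀ ω, cs.IsReduced ω → cs.wordProd ω = w → cs.IsReduced (i :: ω) := by
    intro ω r e
    exact cs.isReduced_cons_of_not_isLeftDescent r (by rwa [e])
  have := h (i :: ω) (i :: ω') (hc ω r e) (hc ω' r' e') (by rw [wordProd_cons, e])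
    (by rw [wordProd_cons, e'])
  exact (List.cons.inj this).2

/-- The complement is an upper set. Suppose `μ(y, w) ≠ 0` in `C_i C_w` with `y` uniquely reduced.
The only left descent of `y` is `i`, which is not one of `w`, so every left descent `r` of `w`
satisfies `w = s_r y`; then `w` is uniquely reduced as well. -/
theorem TwoSidedLE.hasUniqueReduced {x y : W} (h : cs.TwoSidedLE x y)
    (hy : cs.HasUniqueReduced y) : cs.HasUniqueReduced x := by
  by_contra hx
  refine TwoSidedLE.mem cs (A := {w | ¬ cs.HasUniqueReduced w}) ?_ ?_ h hx hy
  · intro w hw hw'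
    exact hw (inv_inv w ▸ hw'.inv)
  · intro w hw i hi
    refine ⟨fun h => hw (h.of_simple_mul cs hi), fun y hy hy' => hw ?_⟩
    obtain ⟨hyi, -, hc, -⟩ := cs.of_muCoeff_ne_zero hy
    refine hy'.of_forall_isLeftDescent cs fun r hr => ?_
    have hyr : ¬ cs.IsLeftDescent y r := by
      intro hyr
      rw [hy'.eq_of_isLeftDescent cs hyi hyr] at hi
      exact hi hr
    rw [coeff_one_repr_klBasis cs hr hyr] at hc
    by_contra hne
    rw [if_neg fun h => hne h.symm] at hc
    exact hc rfl

/-- The second letter `j` of the reduced word is a left descent of `s_i w` but not of `w`, and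
`μ(s_i w, w) = 1`. So `C_{s_i w}` appears in `C_j C_w`. -/
theorem HasUniqueReduced.twoSidedLE_simple_mul {w : W} (h : cs.HasUniqueReduced w) {i : B}
    (hi : cs.IsLeftDescent w i) (h1 : cs.simple i * w ≠ 1) :
    cs.TwoSidedLE w (cs.simple i * w) := by
  obtain ⟨j, hj⟩ := cs.exists_leftDescent_of_ne_one h1
  have hi' : ¬ cs.IsLeftDescent (cs.simple i * w) i :=
    cs.isLeftDescent_iff_not_isLeftDescent_mul.mp hi
  have hwj : ¬ cs.IsLeftDescent w j := by
    intro hwj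
    rw [← h.eq_of_isLeftDescent cs hi hwj] at hj
    exact hi' hj
  have hl := cs.isLeftDescent_iff.mp hi
  have hl' := cs.not_isLeftDescent_iff.mp hwj
  refine Relation.ReflTransGen.single ⟨cs.simple j, 1, ?_⟩
  rw [klBasis_one, mul_one, klBasis_simple]
  refine cs.appearsIn_klGen_mul hwj ?_
  have hne : cs.simple j * w ≠ cs.simple i * w := by
    intro h
    rw [h] at hl'
    omega
  -- The leading term sits at the longer element `s_j w`, so it does not interfere with the
  -- coefficient at `s_i w`.
  rw [Finsupp.add_apply, Finsupp.single_eq_of_ne' hne, zero_add, muCoeff_apply,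
    if_pos ⟨hj, by omega⟩, coeff_one_repr_klBasis cs hi hi', simple_mul_simple_cancel_left,
    if_pos rfl, map_one]
  exact one_ne_zero

theorem HasUniqueReduced.exists_simple {w : W} (h : cs.HasUniqueReduced w) (hw : w ≠ 1) :
    ∃ i, cs.TwoSidedLE (cs.simple i) w ∧ cs.TwoSidedLE w (cs.simple i) := by
  obtain ⟨n, hn⟩ : ∃ n, n = cs.length w := ⟨_, rfl⟩
  induction n generalizing w with
  | zero => exact absurd (cs.length_eq_zero_iff.mp hn.symm) hw
  | succ n ih =>
    obtain ⟨i, hi⟩ := cs.exists_leftDescent_of_ne_one hw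
    by_cases h1 : cs.simple i * w = 1
    · have : w = cs.simple i := by
        rw [← cs.simple_mul_simple_cancel_left (w := w) i, h1, mul_one]
      exact ⟨i, this ▸ Relation.ReflTransGen.refl, this ▸ Relation.ReflTransGen.refl⟩
    have hi' : ¬ cs.IsLeftDescent (cs.simple i * w) i :=
      cs.isLeftDescent_iff_not_isLeftDescent_mul.mp hi
    have hl := cs.isLeftDescent_iff.mp hi
    have hu : cs.HasUniqueReduced (cs.simple i * w) :=
      HasUniqueReduced.of_simple_mul cs hi' (by rwa [simple_mul_simple_cancel_left])
    obtain ⟨j, h2, h3⟩ := ih hu h1 (by omega)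
    have h4 := cs.twoSidedLE_simple_mul hi'
    rw [simple_mul_simple_cancel_left] at h4
    exact ⟨j, h2.trans h4, (h.twoSidedLE_simple_mul cs hi h1).trans h3⟩

theorem simple_ne_one (i : B) : cs.simple i ≠ 1 := by
  intro h
  have := cs.length_simple i
  rw [h, length_one] at this
  omega

theorem isRigid_pair {i j : B} (h : M.diagram.Adj i j) : M.IsRigid [i, j] := by
  constructor
  · intro a ha
    have := ha.eq_of_length rfl
    simp only [List.cons.injEq, and_true] at this
    exact h.1 (this.1.symm.trans this.2)
  · intro a b hab h0 ha
    have hlen := ha.length_le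
    rw [length_altFrom] at hlen
    have h1 := M.off_diagonal a b hab
    have h2 : M a b = 2 := by simp at hlen; omega
    have := ha.eq_of_length (by rw [length_altFrom, h2]; rfl)
    rw [h2] at this
    simp only [altFrom, List.cons.injEq, and_true] at this
    rw [this.1, this.2] at h2
    exact h.2 h2

theorem hasUniqueReduced_simple (i : B) : cs.HasUniqueReduced (cs.simple i) := by
  have : M.IsRigid [i] := by
    constructor
    · intro a ha
      simpa using ha.length_le
    · intro a b hab h0 ha
      have hlen := ha.length_le
      rw [length_altFrom] at hlen
      have h1 := M.off_diagonal a b hab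
      simp at hlen
      omega
  simpa using cs.hasUniqueReduced_of_isRigid this

/-- The small cell consists of the non-trivial elements with a unique reduced expression. -/
theorem smallCell_eq : cs.smallCell = {w | w ≠ 1 ∧ cs.HasUniqueReduced w} := by
  ext w
  constructor
  · rintro ⟨i, h1, h2⟩
    exact ⟨TwoSidedLE.ne_one cs h1 (cs.simple_ne_one i),
      TwoSidedLE.hasUniqueReduced cs h2 (cs.hasUniqueReduced_simple i)⟩
  · rintro ⟨h1, h2⟩
    exact h2.exists_simple cs h1

theorem twoSidedLE_mul_of_adj {i j : B} (h : M.diagram.Adj i j) :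
    cs.TwoSidedLE (cs.simple i * cs.simple j) (cs.simple j) ∧
      cs.TwoSidedLE (cs.simple j) (cs.simple i * cs.simple j) := by
  have hr := isRigid_pair h
  have hu := cs.hasUniqueReduced_of_isRigid hr
  have hred := (cs.isReduced_and_unique_of_isRigid hr).1
  have hd := hred.isLeftDescent_cons
  have e : cs.wordProd [i, j] = cs.simple i * cs.simple j := by simp [wordProd_cons]
  rw [e] at hu hd
  have hd' := cs.isLeftDescent_iff_not_isLeftDescent_mul.mp hd
  have h1 := hu.twoSidedLE_simple_mul cs hd
    (by rw [simple_mul_simple_cancel_left]; exact cs.simple_ne_one j)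
  rw [simple_mul_simple_cancel_left] at h1 hd'
  exact ⟨h1, cs.twoSidedLE_simple_mul hd'⟩

/-- The product `s_i s_j` has one reduced expression and links both letters: `s_i ≤ s_i s_j ≤ s_j`,
the first step by inverting `s_i ≤ s_j s_i`. -/
theorem twoSidedLE_simple_of_adj {i j : B} (h : M.diagram.Adj i j) :
    cs.TwoSidedLE (cs.simple i) (cs.simple j) := by
  have h1 := (cs.twoSidedLE_mul_of_adj h).1
  have h2 := TwoSidedLE.inv cs (cs.twoSidedLE_mul_of_adj h.symm).2
  rw [mul_inv_rev, inv_simple, inv_simple] at h2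
  exact h2.trans h1

theorem twoSidedLE_simple_of_connected (h : M.diagram.Connected) (i j : B) :
    cs.TwoSidedLE (cs.simple i) (cs.simple j) := by
  obtain ⟨p⟩ := h.preconnected i j
  induction p with
  | nil => exact Relation.ReflTransGen.refl
  | cons h _ ih => exact (cs.twoSidedLE_simple_of_adj h).trans ih

theorem isTwoSidedCell_smallCell (h : M.diagram.Connected) : cs.IsTwoSidedCell cs.smallCell := by
  obtain ⟨i⟩ := h.nonempty
  refine ⟨cs.simple i, Set.ext fun w => ⟨?_, fun hw => ⟨i, hw⟩⟩⟩
  rintro ⟨j, h1, h2⟩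
  exact ⟨(cs.twoSidedLE_simple_of_connected h i j).trans h1,
    h2.trans (cs.twoSidedLE_simple_of_connected h j i)⟩

end CoxeterSystem

end

theorem proposition2p2 {B W : Type*} [Finite B] [Group W] {M : CoxeterMatrix B}
    (cs : CoxeterSystem M W) (hM : M.IsIndecomposable) :
    cs.IsTwoSidedCell cs.smallCell ∧
      (cs.smallCell.Finite ↔
        M.diagram.IsTree ∧
        M.labeledEdges.Subsingleton ∧
        ∀ e ∈ M.diagram.edgeSet, M.label e ≠ ⊤) := by
  refine ⟨cs.isTwoSidedCell_smallCell hM.connected, ?_⟩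
  rw [cs.smallCell_eq, cs.finite_hasUniqueReduced_iff, CoxeterMatrix.finite_isRigid_iff hM]
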